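/- Theorem. Let $\Delta$ be an upward equilateral triangle of side length $n$, divided into unit triangles, and let $S$ be a set of upward grid-aligned triangular holes in $\Delta$ with disjoint interiors, of positive integer side lengths ("sizes") that sum to $n$ (for instance $n$ unit holes). Suppose that $S$ is spread-out: $\sum_{s\in S}\operatorname{size}(s\cap T)\le\operatorname{size}(T)$ for every upward grid-aligned triangle $T\subseteq\Delta$ of positive size (where $\operatorname{size}$ is $0$ for an empty or one-point intersection). Call $T$ saturated if equality holds. A tiling is a tiling of $\Delta\setminus\bigcup S$ by unit rhombi, each formed by two adjacent unit triangles of the grid. A unit segment of the grid is forced if in every tiling it lies on the boundary of some rhombus or of some hole. For a saturated triangle $T$ and one of its three corners, place rhombi repeatedly in this corner, as follows. Let $\sigma$ be the direction of the side of $T$ opposite to the corner. A rhombus may be placed if it lies in $T$, does not overlap any hole, has its two halves joined along a segment of direction $\sigma$, and each of the other two sides of its upward half lies on the boundary of $T$ or on the boundary of a rhombus already placed in this corner. Continue until no further rhombus can be placed. 1. Every unit segment on the boundary of a saturated triangle that is not in the interior of a hole is forced. 2. Every rhombus placed in a corner of a saturated triangle belongs to every tiling; in particular its four sides are forced. 3.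 Every forced segment is on the boundary of a saturated triangle, or is a side of a rhombus that is placed in a corner of a saturated triangle. 4. There is an algorithm which, given $n$ and a list of the holes (positions and sizes) of any such arrangement, outputs the list of all forced segments in a number of steps bounded by a polynomial in $n$. Here an algorithm is a program for a random access machine whose arithmetic operations are addition and truncated subtraction, each operation counting as one step. -/

import Mathlib

/-! Lattice points of the triangular grid are pairs `(x, y)` of naturals, standing for
`x • (1, 0) + y • (1/2, √3/2)` in the plane. -/

namespace HoleyTriangle

/-- The three sides of an upward triangle. -/
inductive Side
  | bottom
  | left
  | right

/-- Unit triangles of the grid. `up x y` has the vertices `(x, y)`, `(x+1, y)`, `(x, y+1)`;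
`down x y` has the vertices `(x+1, y)`, `(x, y+1)`, `(x+1, y+1)`. -/
inductive Cell
  | up (x y : ℕ)
  | down (x y : ℕ)

/-- Unit segments of the grid. Each one is a side of exactly one upward unit triangle;
`⟨x, y, s⟩` is the side `s` of `up x y`. -/
@[ext] structure Segment where
  x : ℕ
  y : ℕ
  side : Side

/-- The three unit segments that bound a unit triangle. -/
def Cell.sides : Cell → Set Segment
  | .up x y => {⟨x, y, .bottom⟩, ⟨x, y, .left⟩, ⟨x, y, .right⟩}
  | .down x y => {⟨x, y + 1, .bottom⟩, ⟨x + 1, y, .left⟩, ⟨x, y, .right⟩}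

/-- The unit segments on the boundary of a region: the sides of exactly one of its cells. -/
def boundary (A : Set Cell) : Set Segment := {e | ∃! c, c ∈ A ∧ e ∈ c.sides}

/-- The unit segments in the interior of a region: the sides of two of its cells. -/
def interiorSegments (A : Set Cell) : Set Segment :=
  {e | ∃ c ∈ A, ∃ c' ∈ A, c ≠ c' ∧ e ∈ c.sides ∧ e ∈ c'.sides}

/-- The upward grid triangle with the vertices `(x, y)`, `(x + size, y)`, `(x, y + size)`. -/
@[ext] structure Tri where
  x : ℕ
  y : ℕ
  size : ℕ

/-- The unit triangles contained in an upward triangle. -/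
def Tri.cells (T : Tri) : Set Cell :=
  {c | match c with
    | .up a b => T.x ≤ a ∧ T.y ≤ b ∧ a + b < T.x + T.y + T.size
    | .down a b => T.x ≤ a ∧ T.y ≤ b ∧ a + b + 1 < T.x + T.y + T.size}

/-- The intersection of two upward triangles. Its size is a truncated difference: it is `0` if the
intersection is empty or a point. -/
def Tri.inter (s T : Tri) : Tri where
  x := max s.x T.x
  y := max s.y T.y
  size := min (s.x + s.y + s.size) (T.x + T.y + T.size) - (max s.x T.x + max s.y T.y)

theorem Tri.cells_inter (s T : Tri) : (s.inter T).cells = s.cells ∩ T.cells := by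
  ext c
  cases c <;> simp only [Tri.cells, Tri.inter, Set.mem_inter_iff, Set.mem_ofPred_eq] <;> omega

/-- The big triangle `Δ` of side length `n`. -/
def big (n : ℕ) : Tri := ⟨0, 0, n⟩

/-- `T` is a nondegenerate upward triangle inside `Δ`. -/
def Tri.Inside (n : ℕ) (T : Tri) : Prop := 0 < T.size ∧ T.x + T.y + T.size ≤ n

/-- An arrangement of triangular holes in `Δ`: upward triangles inside `Δ` with disjoint interiors,
whose sizes sum to `n`. -/
structure IsArrangement (n : ℕ) (S : Finset Tri) : Prop where
  inside : ∀ s ∈ S, s.Inside n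
  disjoint : ∀ s ∈ S, ∀ t ∈ S, s ≠ t → Disjoint s.cells t.cells
  sum_size : ∑ s ∈ S, s.size = n

/-- Every upward triangle `T` inside `Δ` satisfies `∑ size (s ∩ T) ≤ size T`. -/
def SpreadOut (n : ℕ) (S : Finset Tri) : Prop :=
  ∀ T : Tri, T.Inside n → ∑ s ∈ S, (s.inter T).size ≤ T.size

/-- An upward triangle `T` inside `Δ` with `∑ size (s ∩ T) = size T`. -/
def Saturated (n : ℕ) (S : Finset Tri) (T : Tri) : Prop :=
  T.Inside n ∧ ∑ s ∈ S, (s.inter T).size = T.size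

/-- The unit triangles covered by the holes. -/
def holeCells (S : Finset Tri) : Set Cell := {c | ∃ s ∈ S, c ∈ s.cells}

/-- The region to be tiled: `Δ` with the holes removed. -/
def region (n : ℕ) (S : Finset Tri) : Set Cell := (big n).cells \ holeCells S

/-- Unit rhombi: the rhombus `⟨x, y, s⟩` consists of `down x y` and the upward unit triangle whose
side `s` is a side of `down x y`. -/
@[ext] structure Rhombus where
  x : ℕ
  y : ℕ
  side : Side

/-- The downward half of a rhombus. -/
def Rhombus.downCell (r : Rhombus) : Cell := .down r.x r.y

/-- The segment shared by the two halves of a rhombus (its short diagonal). -/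
def Rhombus.diagonal (r : Rhombus) : Segment :=
  match r.side with
  | .bottom => ⟨r.x, r.y + 1, .bottom⟩
  | .left => ⟨r.x + 1, r.y, .left⟩
  | .right => ⟨r.x, r.y, .right⟩

/-- The upward half of a rhombus. -/
def Rhombus.upCell (r : Rhombus) : Cell := .up r.diagonal.x r.diagonal.y

def Rhombus.cells (r : Rhombus) : Set Cell := {r.upCell, r.downCell}

/-- A set of rhombi tiles `Δ` with the holes removed. -/
structure IsTiling (n : ℕ) (S : Finset Tri) (R : Set Rhombus) : Prop where
  subset_region : ∀ r ∈ R, r.cells ⊆ region n S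
  covers : ∀ c ∈ region n S, ∃! r, r ∈ R ∧ c ∈ r.cells

/-- The segments that are part of a tiling: those on the boundary of a tile (rhombus or hole). -/
def tilingSegments (S : Finset Tri) (R : Set Rhombus) : Set Segment :=
  {e | (∃ r ∈ R, e ∈ boundary r.cells) ∨ ∃ s ∈ S, e ∈ boundary s.cells}

/-- The segment `e` is part of every tiling with the given holes. -/
def Forced (n : ℕ) (S : Finset Tri) (e : Segment) : Prop :=
  ∀ R : Set Rhombus, IsTiling n S R → e ∈ tilingSegments S R

/-- `CornerPlaced S T σ r`: the rhombus `r` gets placed when rhombi are placed repeatedly in the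
corner of `T` opposite to the side `σ`, as long as the holes `S` do not obstruct them. All these
rhombi are joined across the side `σ` of their upward half. A rhombus can be placed if it lies in
`T`, avoids the holes, and each of the other two sides of its upward half lies on the boundary of
`T` or on a rhombus already placed (that is, every unit triangle of `T` across this side is
covered by a rhombus already placed). -/
inductive CornerPlaced (S : Finset Tri) (T : Tri) (σ : Side) : Rhombus → Prop
  | place (r : Rhombus) (side_eq : r.side = σ) (inside : r.cells ⊆ T.cells)
      (unobstructed : Disjoint r.cells (holeCells S))
      (corner : ∀ e ∈ r.upCell.sides, e ≠ r.diagonal →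
        ∀ x y : ℕ, e ∈ (Cell.down x y).sides → Cell.down x y ∈ T.cells →
          CornerPlaced S T σ ⟨x, y, σ⟩) :
      CornerPlaced S T σ r

/-! A random access machine with structured programs. The memory consists of arrays of natural
numbers; the only arithmetic operations are addition and truncated subtraction, so that unit cost
per operation is polynomially equivalent to bit cost. -/

/-- `m a i` is the content of cell `i` of array `a`. -/
abbrev Memory := ℕ → ℕ → ℕ

/-- Overwrite cell `i` of array `a` by `v`. -/
def Memory.write (m : Memory) (a i v : ℕ) : Memory :=
  Function.update m a (Function.update (m a) i v)

inductive Expr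
  | const (k : ℕ)
  | read (a : ℕ) (index : Expr)
  | add (e f : Expr)
  | sub (e f : Expr)

def Expr.eval (m : Memory) : Expr → ℕ
  | .const k => k
  | .read a i => m a (i.eval m)
  | .add e f => e.eval m + f.eval m
  | .sub e f => e.eval m - f.eval m

/-- The number of steps needed to evaluate an expression: one per operation. -/
def Expr.cost : Expr → ℕ
  | .const _ => 1
  | .read _ i => i.cost + 1
  | .add e f => e.cost + f.cost + 1
  | .sub e f => e.cost + f.cost + 1

inductive Program
  | skip
  | assign (a : ℕ) (index value : Expr)
  | seq (p q : Program)
  | cond (test : Expr) (p q : Program)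
  | loop (test : Expr) (p : Program)

/-- `Run p m t m'`: the program `p`, started on the memory `m`, halts after exactly `t` steps with
the memory `m'`. A test succeeds if its value is nonzero. -/
inductive Run : Program → Memory → ℕ → Memory → Prop
  | skip (m : Memory) : Run .skip m 1 m
  | assign (a : ℕ) (i v : Expr) (m : Memory) :
      Run (.assign a i v) m (i.cost + v.cost + 1) (m.write a (i.eval m) (v.eval m))
  | seq {p q : Program} {m₁ m₂ m₃ : Memory} {t t' : ℕ} :
      Run p m₁ t m₂ → Run q m₂ t' m₃ → Run (.seq p q) m₁ (t + t') m₃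
  | cond_true {b : Expr} {p q : Program} {m m' : Memory} {t : ℕ} :
      b.eval m ≠ 0 → Run p m t m' → Run (.cond b p q) m (b.cost + 1 + t) m'
  | cond_false {b : Expr} {p q : Program} {m m' : Memory} {t : ℕ} :
      b.eval m = 0 → Run q m t m' → Run (.cond b p q) m (b.cost + 1 + t) m'
  | loop_true {b : Expr} {p : Program} {m₁ m₂ m₃ : Memory} {t t' : ℕ} :
      b.eval m₁ ≠ 0 → Run p m₁ t m₂ → Run (.loop b p) m₂ t' m₃ →
        Run (.loop b p) m₁ (b.cost + 1 + t + t') m₃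
  | loop_false {b : Expr} {p : Program} {m : Memory} :
      b.eval m = 0 → Run (.loop b p) m (b.cost + 1) m

/-- The input: array `0` holds `n` and the number of holes, arrays `1`, `2`, `3` hold the
coordinates and the sizes of the holes; everything else is zero. -/
def inputMemory (n : ℕ) (holes : List Tri) : Memory
  | 0, 0 => n
  | 0, 1 => holes.length
  | 1, i => (holes.map Tri.x).getD i 0
  | 2, i => (holes.map Tri.y).getD i 0
  | 3, i => (holes.map Tri.size).getD i 0
  | _, _ => 0

def Side.code : Side → ℕ
  | .bottom => 0
  | .left => 1
  | .right => 2

def Segment.code (e : Segment) : ℕ × ℕ × ℕ := (e.x, e.y, e.side.code)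

/-- The output: a list of triples of numbers, its length in cell `0` of array `4`, the three
components of its entries in the arrays `5`, `6`, `7`. -/
def output (m : Memory) : List (ℕ × ℕ × ℕ) :=
  (List.range (m 4 0)).map fun i => (m 5 i, m 6 i, m 7 i)

/-- The program `p`, given `n` and any list of the holes of a spread-out arrangement in a triangle
of side length `n`, finds the forced segments in at most `time n` steps. -/
def FindsForcedSegments (p : Program) (time : ℕ → ℕ) : Prop :=
  ∀ (n : ℕ) (S : Finset Tri) (holes : List Tri), IsArrangement n S → SpreadOut n S →
    holes.Nodup → (∀ s, s ∈ holes ↔ s ∈ S) →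
    ∃ (t : ℕ) (m : Memory), Run p (inputMemory n holes) t m ∧ t ≤ time n ∧
      {w | w ∈ output m} = Segment.code '' {e | Forced n S e}

end HoleyTriangle

open HoleyTriangle

/-! A tiling is a perfect matching between the downward and the upward unit triangles outside the
holes. An upward triangle has exactly `size` more upward than downward cells, so spread-outness says
that no triangle has more free downward cells than free upward cells. A saturated triangle has
equally many of both.

Saturation forces: the neighbours of a downward cell of `T` lie in `T`. If `T` is balanced, the
partners of its downward cells use up all its free upward cells, and no rhombus crosses its boundary
(`IsTiling.exists_rhombus`). Going inwards from a corner, every other partner of an upward cell is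
already taken, so the placed rhombi are forced as well (`CornerPlaced.mem_tiling`).

Conversely, let `e` separate the free cells `u` (upward) and `d` (downward). It is not forced if
some matching pairs `d` with `u`, since `e` is then a diagonal. By Hall's theorem one needs `|X| ≤
|N(X)|` for sets `X` of free downward cells without `d`, where `N(X)` counts free neighbours other
than `u`. By `exists_pieces` it suffices to check a few shapes: triangles without `d`, triangles
with the parallelogram between `d` and a corner cut off, and triangles with only `d` removed.
Disjoint shapes of this kind cover any `X`, because two that overlap fit into a single one of
smaller total surplus (`IsPiece.merge`). If the first shape violates the condition, then `e` is on
the boundary of a saturated triangle; if the second does, the triangle is saturated and the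
parallelogram is free of holes, so `e` is a side of a placed rhombus; the third never does
(`card_piece_le`).

For the algorithm, `cornerPlaced_iff` replaces the recursive placement by the condition that a
parallelogram contains no hole cell. Being forced then becomes a formula whose quantifiers range
over `0, ..., n`, and exhaustive evaluation takes polynomial time. -/

namespace HoleyTriangle

open Finset

/-! ### Unit triangles as pairs of coordinates -/

/-- The upward cell across the side `s` of `down a b` is `up (a, b) + s.offset`. -/
def Side.offset : Side → ℕ × ℕ
  | .bottom => (0, 1)
  | .left => (1, 0)
  | .right => (0, 0)

/-- The three upward cells adjacent to a downward cell. -/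
def nbrs (z : ℕ × ℕ) : Finset (ℕ × ℕ) := {z, (z.1 + 1, z.2), (z.1, z.2 + 1)}

theorem mem_nbrs {z v : ℕ × ℕ} :
    v ∈ nbrs z ↔ (v.1 = z.1 ∧ v.2 = z.2) ∨ (v.1 = z.1 + 1 ∧ v.2 = z.2) ∨
      (v.1 = z.1 ∧ v.2 = z.2 + 1) := by
  simp [nbrs, Prod.ext_iff]

theorem mem_nbrs_iff_offset {z v : ℕ × ℕ} : v ∈ nbrs z ↔ ∃ s : Side, v = z + s.offset := by
  rw [mem_nbrs]
  constructor
  · rintro (h | h | h)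
    · exact ⟨.right, Prod.ext h.1 h.2⟩
    · exact ⟨.left, Prod.ext h.1 h.2⟩
    · exact ⟨.bottom, Prod.ext h.1 h.2⟩
  · rintro ⟨s, rfl⟩
    cases s <;> simp [Side.offset]

theorem card_nbrs (z : ℕ × ℕ) : (nbrs z).card = 3 := by
  rw [nbrs, card_eq_three]
  exact ⟨_, _, _, by simp [Prod.ext_iff], by simp [Prod.ext_iff], by simp, rfl⟩

/-- The upward cells of an upward triangle. -/
def Tri.ups (T : Tri) : Finset (ℕ × ℕ) :=
  (range (T.x + T.y + T.size) ×ˢ range (T.x + T.y + T.size)).filter fun v =>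
    T.x ≤ v.1 ∧ T.y ≤ v.2 ∧ v.1 + v.2 < T.x + T.y + T.size

/-- The downward cells of an upward triangle. -/
def Tri.downs (T : Tri) : Finset (ℕ × ℕ) :=
  (range (T.x + T.y + T.size) ×ˢ range (T.x + T.y + T.size)).filter fun v =>
    T.x ≤ v.1 ∧ T.y ≤ v.2 ∧ v.1 + v.2 + 1 < T.x + T.y + T.size

theorem Tri.mem_ups {T : Tri} {v : ℕ × ℕ} :
    v ∈ T.ups ↔ T.x ≤ v.1 ∧ T.y ≤ v.2 ∧ v.1 + v.2 < T.x + T.y + T.size := by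
  simp only [Tri.ups, mem_filter, mem_product, mem_range]
  omega

theorem Tri.mem_downs {T : Tri} {v : ℕ × ℕ} :
    v ∈ T.downs ↔ T.x ≤ v.1 ∧ T.y ≤ v.2 ∧ v.1 + v.2 + 1 < T.x + T.y + T.size := by
  simp only [Tri.downs, mem_filter, mem_product, mem_range]
  omega

/-- Every upward cell above the bottom row sits on top of exactly one downward cell, so the surplus
is the bottom row. All counting below rests on this. -/
theorem Tri.card_ups (T : Tri) : T.ups.card = T.downs.card + T.size := by
  have h : T.ups = T.downs.image (fun z => (z.1, z.2 + 1)) ∪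
      (range T.size).image fun i => (T.x + i, T.y) := by
    ext ⟨a, b⟩
    simp only [Tri.mem_ups, mem_union, mem_image, Tri.mem_downs, mem_range, Prod.exists,
      Prod.mk.injEq]
    constructor
    · rintro ⟨h1, h2, h3⟩
      by_cases hb : b = T.y
      · exact Or.inr ⟨a - T.x, by omega, by omega, by omega⟩
      · exact Or.inl ⟨a, b - 1, by omega, rfl, by omega⟩
    · rintro (⟨a', b', h, h4, h5⟩ | ⟨i, hi, h4, h5⟩) <;> omega
  rw [h, card_union_of_disjoint, card_image_of_injective, card_image_of_injective, card_range]
  · intro i j hij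
    simpa using hij
  · rintro ⟨a, b⟩ ⟨c, e⟩ hij
    simpa using hij
  · rw [Finset.disjoint_left]
    rintro ⟨a, b⟩ h1 h2
    simp only [mem_image, Tri.mem_downs, mem_range, Prod.exists, Prod.mk.injEq] at h1 h2
    obtain ⟨a', b', h, h4, h5⟩ := h1
    obtain ⟨i, hi, h6, h7⟩ := h2
    omega

theorem Tri.nbrs_subset_ups {T : Tri} {z : ℕ × ℕ} : nbrs z ⊆ T.ups ↔ z ∈ T.downs := by
  constructor
  · intro h
    have h1 := Tri.mem_ups.1 (h (show z ∈ nbrs z by simp [nbrs]))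
    have h2 := Tri.mem_ups.1 (h (show (z.1 + 1, z.2) ∈ nbrs z by simp [nbrs]))
    rw [Tri.mem_downs]
    simp only at h2
    omega
  · intro h v hv
    rw [Tri.mem_downs] at h
    rw [mem_nbrs] at hv
    rw [Tri.mem_ups]
    omega

theorem Tri.mem_downs_of_two {T : Tri} {z v w : ℕ × ℕ} (hv : v ∈ nbrs z) (hw : w ∈ nbrs z)
    (hne : v ≠ w) (hvT : v ∈ T.ups) (hwT : w ∈ T.ups) : z ∈ T.downs := by
  rw [Ne, Prod.ext_iff] at hne
  rw [mem_nbrs] at hv hw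
  rw [Tri.mem_ups] at hvT hwT
  rw [Tri.mem_downs]
  omega

/-! ### Hulls of two triangles -/

/-- The smallest upward triangle containing two given ones. -/
def Tri.hull (T T' : Tri) : Tri where
  x := min T.x T'.x
  y := min T.y T'.y
  size := max (T.x + T.y + T.size) (T'.x + T'.y + T'.size) - (min T.x T'.x + min T.y T'.y)

theorem Tri.ups_subset_hull (T T' : Tri) : T.ups ⊆ (T.hull T').ups := by
  intro v hv
  rw [Tri.mem_ups] at hv ⊢
  simp only [Tri.hull]
  omega

theorem Tri.downs_subset_hull (T T' : Tri) : T.downs ⊆ (T.hull T').downs := by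
  intro v hv
  rw [Tri.mem_downs] at hv ⊢
  simp only [Tri.hull]
  omega

theorem Tri.ups_subset_hull_right (T T' : Tri) : T'.ups ⊆ (T.hull T').ups := by
  intro v hv
  rw [Tri.mem_ups] at hv ⊢
  simp only [Tri.hull]
  omega

theorem Tri.downs_subset_hull_right (T T' : Tri) : T'.downs ⊆ (T.hull T').downs := by
  intro v hv
  rw [Tri.mem_downs] at hv ⊢
  simp only [Tri.hull]
  omega

theorem Tri.Inside.hull {n : ℕ} {T T' : Tri} (h : T.Inside n) (h' : T'.Inside n) :
    (T.hull T').Inside n := by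
  simp only [Tri.Inside, Tri.hull] at *
  omega

theorem Tri.size_hull_of_up {T T' : Tri} {v : ℕ × ℕ} (h : v ∈ T.ups) (h' : v ∈ T'.ups) :
    (T.hull T').size + 1 ≤ T.size + T'.size := by
  rw [Tri.mem_ups] at h h'
  simp only [Tri.hull]
  omega

/-- A common downward cell saves one unit more than a common upward cell. This unit pays for the
removal of `d` from the hull. -/
theorem Tri.size_hull_of_down {T T' : Tri} {v : ℕ × ℕ} (h : v ∈ T.downs) (h' : v ∈ T'.downs) :
    (T.hull T').size + 2 ≤ T.size + T'.size := by
  rw [Tri.mem_downs] at h h'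
  simp only [Tri.hull]
  omega

/-! ### Triangles with a corner cut off -/

/-- The downward cells between the downward cell `d` and the corner opposite to the side `σ`. -/
def InSector (d : ℕ × ℕ) : Side → ℕ × ℕ → Prop
  | .bottom, z => z.1 ≤ d.1 ∧ d.1 + d.2 ≤ z.1 + z.2
  | .right, z => z.1 ≤ d.1 ∧ z.2 ≤ d.2
  | .left, z => z.2 ≤ d.2 ∧ d.1 + d.2 ≤ z.1 + z.2

/-- The upward cells across the sides `σ` of the downward cells in a sector. -/
def InUpSector (d : ℕ × ℕ) : Side → ℕ × ℕ → Prop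
  | .bottom, v => v.1 ≤ d.1 ∧ d.1 + d.2 + 1 ≤ v.1 + v.2
  | .right, v => v.1 ≤ d.1 ∧ v.2 ≤ d.2
  | .left, v => v.2 ≤ d.2 ∧ d.1 + d.2 + 1 ≤ v.1 + v.2

theorem inSector_self (d : ℕ × ℕ) (σ : Side) : InSector d σ d := by
  cases σ <;> simp [InSector]

theorem inUpSector_add_offset {d z : ℕ × ℕ} {σ : Side} :
    InUpSector d σ (z + σ.offset) ↔ InSector d σ z := by
  cases σ <;> simp only [InUpSector, InSector, Side.offset, Prod.fst_add, Prod.snd_add] <;> omega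

theorem not_inUpSector_of_mem_nbrs {d z v : ℕ × ℕ} {σ : Side} (hv : v ∈ nbrs z)
    (hz : ¬ InSector d σ z) : ¬ InUpSector d σ v := by
  rw [mem_nbrs] at hv
  cases σ <;> simp only [InUpSector, InSector] at * <;> omega

/-- The tip has to be excepted: of its three neighbours, only the one across `σ` is in the upward
sector. -/
theorem inUpSector_of_two {d z v w : ℕ × ℕ} {σ : Side} (hv : v ∈ nbrs z) (hw : w ∈ nbrs z)
    (hne : v ≠ w) (hz : InSector d σ z) (hd : z ≠ d) : InUpSector d σ v ∨ InUpSector d σ w := by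
  rw [Ne, Prod.ext_iff] at hne hd
  rw [mem_nbrs] at hv hw
  cases σ <;> simp only [InUpSector, InSector] at * <;> omega

theorem exists_add_offset_of_inUpSector {T : Tri} {d v : ℕ × ℕ} {σ : Side} (hd : d ∈ T.downs)
    (hvT : v ∈ T.ups) (hv : InUpSector d σ v) :
    ∃ z ∈ T.downs, InSector d σ z ∧ v = z + σ.offset := by
  obtain ⟨a, b⟩ := v
  rw [Tri.mem_downs] at hd
  rw [Tri.mem_ups] at hvT
  cases σ
  · refine ⟨(a, b - 1), ?_⟩
    simp only [InUpSector, InSector, Side.offset, Tri.mem_downs, Prod.ext_iff, Prod.fst_add,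
      Prod.snd_add] at *
    omega
  · refine ⟨(a - 1, b), ?_⟩
    simp only [InUpSector, InSector, Side.offset, Tri.mem_downs, Prod.ext_iff, Prod.fst_add,
      Prod.snd_add] at *
    omega
  · refine ⟨(a, b), ?_⟩
    simp only [InUpSector, InSector, Side.offset, Tri.mem_downs, Prod.ext_iff, Prod.fst_add,
      Prod.snd_add] at *
    omega

theorem add_offset_mem_nbrs (z : ℕ × ℕ) (σ : Side) : z + σ.offset ∈ nbrs z :=
  mem_nbrs_iff_offset.2 ⟨σ, rfl⟩

-- Translation by `σ.offset` pairs the two kinds of cells of a sector inside `T`. Hence cutting off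
-- a sector does not change the surplus of a triangle.
open scoped Classical in
theorem card_filter_inUpSector {T : Tri} {d : ℕ × ℕ} (σ : Side) (hd : d ∈ T.downs) :
    (T.ups.filter (InUpSector d σ)).card = (T.downs.filter (InSector d σ)).card := by
  have h : T.ups.filter (InUpSector d σ) =
      (T.downs.filter (InSector d σ)).image (· + σ.offset) := by
    ext v
    simp only [mem_filter, mem_image]
    constructor
    · rintro ⟨h1, h2⟩
      obtain ⟨z, hz, hz', rfl⟩ := exists_add_offset_of_inUpSector hd h1 h2
      exact ⟨z, ⟨hz, hz'⟩, rfl⟩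
    · rintro ⟨z, ⟨hz, hz'⟩, rfl⟩
      exact ⟨Tri.nbrs_subset_ups.2 hz (add_offset_mem_nbrs _ _), inUpSector_add_offset.2 hz'⟩
  rw [h, card_image_of_injective _ (add_left_injective _)]

/-! ### Pieces -/

/-- A finite set of upward cells together with a finite set of downward cells. -/
abbrev Piece := Finset (ℕ × ℕ) × Finset (ℕ × ℕ)

/-- The cost is additive over disjoint pieces. It is to be compared with `|N(Z)| - |Z|` for a set
`Z` of downward cells. -/
def Piece.cost (P : Piece) : ℤ := P.1.card - P.2.card

open scoped Classical in
/-- The pieces that determine whether a set of downward cells other than `d` can be matched: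
triangles that do not contain `d`, triangles with the parallelogram between `d` and a corner cut
off, and triangles with the cell `d` removed. -/
inductive IsPiece (n : ℕ) (d : ℕ × ℕ) : Piece → Prop
  | whole (T : Tri) (inside : T.Inside n) (h : d ∉ T.downs) : IsPiece n d (T.ups, T.downs)
  | cut (T : Tri) (inside : T.Inside n) (h : d ∈ T.downs) (σ : Side) :
      IsPiece n d (T.ups.filter (¬ InUpSector d σ ·), T.downs.filter (¬ InSector d σ ·))
  | punctured (T : Tri) (inside : T.Inside n) (h : d ∈ T.downs) :
      IsPiece n d (T.ups, T.downs.erase d)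

theorem cost_whole (T : Tri) : Piece.cost (T.ups, T.downs) = T.size := by
  simp only [Piece.cost, Tri.card_ups]
  push_cast
  ring

open scoped Classical in
theorem cost_cut {T : Tri} {d : ℕ × ℕ} (h : d ∈ T.downs) (σ : Side) :
    Piece.cost (T.ups.filter (¬ InUpSector d σ ·), T.downs.filter (¬ InSector d σ ·)) = T.size := by
  have h1 := card_filter_inUpSector σ h
  have h2 := card_filter_add_card_filter_not (s := T.ups) (InUpSector d σ)
  have h3 := card_filter_add_card_filter_not (s := T.downs) (InSector d σ)
  have h4 := T.card_ups
  simp only [Piece.cost]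
  omega

theorem cost_punctured {T : Tri} {d : ℕ × ℕ} (h : d ∈ T.downs) :
    Piece.cost (T.ups, T.downs.erase d) = T.size + 1 := by
  have h1 := card_erase_add_one h
  have h4 := T.card_ups
  simp only [Piece.cost]
  omega

theorem IsPiece.exists_tri {n : ℕ} {d : ℕ × ℕ} {P : Piece} (h : IsPiece n d P) :
    ∃ T : Tri, T.Inside n ∧ P.1 ⊆ T.ups ∧ P.2 ⊆ T.downs.erase d ∧ (T.size : ℤ) ≤ P.cost := by
  classical
  rcases h with ⟨T, hT, hd⟩ | ⟨T, hT, hd, σ⟩ | ⟨T, hT, hd⟩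
  · exact ⟨T, hT, subset_rfl, by rw [erase_eq_of_notMem hd], (cost_whole T).ge⟩
  · refine ⟨T, hT, filter_subset _ _, ?_, (cost_cut hd σ).ge⟩
    intro z hz
    rw [mem_filter] at hz
    refine mem_erase.2 ⟨?_, hz.1⟩
    rintro rfl
    exact hz.2 (inSector_self _ _)
  · exact ⟨T, hT, subset_rfl, subset_rfl, by rw [cost_punctured hd]; omega⟩

theorem IsPiece.nbrs_subset {n : ℕ} {d : ℕ × ℕ} {P : Piece} (h : IsPiece n d P) {z : ℕ × ℕ}
    (hz : z ∈ P.2) : nbrs z ⊆ P.1 := by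
  classical
  rcases h with ⟨T, hT, hd⟩ | ⟨T, hT, hd, σ⟩ | ⟨T, hT, hd⟩
  · exact Tri.nbrs_subset_ups.2 hz
  · rw [mem_filter] at hz
    exact fun v hv => mem_filter.2
      ⟨Tri.nbrs_subset_ups.2 hz.1 hv, not_inUpSector_of_mem_nbrs hv hz.2⟩
  · exact Tri.nbrs_subset_ups.2 (mem_of_mem_erase hz)

/-- Its use: when `z` is in no piece of a family, those of its neighbours that are covered belong to
different pieces, so that each of them accounts for a separate merge. -/
theorem IsPiece.mem_of_two {n : ℕ} {d : ℕ × ℕ} {P : Piece} (h : IsPiece n d P) {z v w : ℕ × ℕ}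
    (hzd : z ≠ d) (hv : v ∈ nbrs z) (hw : w ∈ nbrs z) (hne : v ≠ w) (hvP : v ∈ P.1)
    (hwP : w ∈ P.1) : z ∈ P.2 := by
  classical
  rcases h with ⟨T, hT, hd⟩ | ⟨T, hT, hd, σ⟩ | ⟨T, hT, hd⟩
  · exact Tri.mem_downs_of_two hv hw hne hvP hwP
  · rw [mem_filter] at hvP hwP
    refine mem_filter.2 ⟨Tri.mem_downs_of_two hv hw hne hvP.1 hwP.1, fun hz => ?_⟩
    exact (inUpSector_of_two hv hw hne hz hzd).elim hvP.2 hwP.2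
  · exact mem_erase.2 ⟨hzd, Tri.mem_downs_of_two hv hw hne hvP hwP⟩

theorem IsPiece.cost_pos {n : ℕ} {d : ℕ × ℕ} {P : Piece} (h : IsPiece n d P) : 0 < P.cost := by
  obtain ⟨T, hT, -, -, h'⟩ := h.exists_tri
  have := hT.1
  omega

theorem IsPiece.nonempty {n : ℕ} {d : ℕ × ℕ} {P : Piece} (h : IsPiece n d P) : P.1.Nonempty := by
  have := h.cost_pos
  rw [← card_pos]
  simp only [Piece.cost] at this
  omega

/-- The triangle formed by a downward cell and its neighbours. -/
theorem isPiece_nbrs {n : ℕ} {d z : ℕ × ℕ} (hz : z.1 + z.2 + 1 < n) (hzd : z ≠ d) :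
    IsPiece n d (nbrs z, {z}) := by
  have h1 : (⟨z.1, z.2, 2⟩ : Tri).downs = {z} := by
    ext v
    rw [Tri.mem_downs, mem_singleton, Prod.ext_iff]
    simp only
    omega
  have h2 : (⟨z.1, z.2, 2⟩ : Tri).ups = nbrs z := by
    ext v
    rw [Tri.mem_ups, mem_nbrs]
    simp only
    omega
  rw [← h1, ← h2]
  refine IsPiece.whole _ ⟨by simp, by simp only; omega⟩ ?_
  rw [h1]
  simpa using hzd.symm

/-! ### Merging overlapping pieces -/

/-- Two triangles that do not contain `d` both avoid one of the three sectors of `d`. -/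
theorem Tri.exists_avoids {T T' : Tri} {d : ℕ × ℕ} (hd : d ∉ T.downs) (hd' : d ∉ T'.downs) :
    ∃ σ, ((∀ z ∈ T.downs, ¬ InSector d σ z) ∧ ∀ v ∈ T.ups, ¬ InUpSector d σ v) ∧
      (∀ z ∈ T'.downs, ¬ InSector d σ z) ∧ ∀ v ∈ T'.ups, ¬ InUpSector d σ v := by
  -- A triangle misses `d` because `d` is beyond one of its three sides; it can then meet only one
  -- sector of `d`, called `τ`. Two triangles meet at most two of the three sectors.
  have key : ∀ T : Tri, d ∉ T.downs → ∃ τ, ∀ σ, σ ≠ τ →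
      (∀ z ∈ T.downs, ¬ InSector d σ z) ∧ ∀ v ∈ T.ups, ¬ InUpSector d σ v := by
    intro T hd
    simp only [Tri.mem_ups, Tri.mem_downs] at *
    have h : d.1 < T.x ∨ d.2 < T.y ∨ T.x + T.y + T.size ≤ d.1 + d.2 + 1 := by omega
    rcases h with h | h | h
    · refine ⟨.left, fun σ hσ => ?_⟩
      cases σ <;> simp only [InSector, InUpSector, ne_eq, not_true] at * <;>
        refine ⟨?_, ?_⟩ <;> intros <;> omega
    · refine ⟨.bottom, fun σ hσ => ?_⟩
      cases σ <;> simp only [InSector, InUpSector, ne_eq, not_true] at * <;>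
        refine ⟨?_, ?_⟩ <;> intros <;> omega
    · refine ⟨.right, fun σ hσ => ?_⟩
      cases σ <;> simp only [InSector, InUpSector, ne_eq, not_true] at * <;>
        refine ⟨?_, ?_⟩ <;> intros <;> omega
  obtain ⟨τ, h⟩ := key T hd
  obtain ⟨τ', h'⟩ := key T' hd'
  obtain ⟨σ, hσ, hσ'⟩ : ∃ σ, σ ≠ τ ∧ σ ≠ τ' := by
    cases τ <;> cases τ' <;>
      first
      | (refine ⟨.bottom, ?_, ?_⟩ <;> simp; done)
      | (refine ⟨.left, ?_, ?_⟩ <;> simp; done)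
      | (refine ⟨.right, ?_, ?_⟩ <;> simp; done)
  exact ⟨σ, h σ hσ, h' σ hσ'⟩

/-- A triangle that does not contain `d`, meets a sector of `d` and contains an upward cell of `T`
outside this sector has a downward cell in common with `T`. -/
theorem Tri.exists_common_down {T T' : Tri} {d v w : ℕ × ℕ} {σ : Side} (hd : d ∈ T.downs)
    (hd' : d ∉ T'.downs) (hv : v ∈ T.ups) (hv' : v ∈ T'.ups) (hvσ : ¬ InUpSector d σ v)
    (hw : w ∈ T'.ups) (hwσ : InUpSector d σ w) : ∃ z, z ∈ T.downs ∧ z ∈ T'.downs := by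
  obtain ⟨a, b⟩ := v
  obtain ⟨x, y⟩ := d
  obtain ⟨a', b'⟩ := w
  simp only [Tri.mem_ups, Tri.mem_downs] at *
  cases σ <;> simp only [InUpSector] at hvσ hwσ
  · by_cases h : x < a
    · exact ⟨(x, b), by simp only; omega, by simp only; omega⟩
    · exact ⟨(x + y - b, b), by simp only; omega, by simp only; omega⟩
  · by_cases h : y < b
    · exact ⟨(a, y), by simp only; omega, by simp only; omega⟩
    · exact ⟨(a, x + y - a), by simp only; omega, by simp only; omega⟩
  · by_cases h : x < a
    · exact ⟨(x, b), by simp only; omega, by simp only; omega⟩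
    · exact ⟨(a, y), by simp only; omega, by simp only; omega⟩

/-- The hull without `d` contains both pieces but costs one more than its size, so the hull must
save two units instead of one. -/
theorem IsPiece.merge_of_cost {n : ℕ} {d : ℕ × ℕ} {P P' : Piece} {T T' : Tri}
    (hT : T.Inside n) (hT' : T'.Inside n) (hd : d ∈ T.downs ∨ d ∈ T'.downs)
    (h₁ : P.1 ⊆ T.ups) (h₂ : P.2 ⊆ T.downs.erase d) (h₁' : P'.1 ⊆ T'.ups)
    (h₂' : P'.2 ⊆ T'.downs.erase d)
    (hcost : (T.hull T').size + 2 ≤ P.cost + P'.cost) :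
    ∃ Q, IsPiece n d Q ∧ P.1 ⊆ Q.1 ∧ P.2 ⊆ Q.2 ∧ P'.1 ⊆ Q.1 ∧ P'.2 ⊆ Q.2 ∧
      Q.cost + 1 ≤ P.cost + P'.cost := by
  have hd' : d ∈ (T.hull T').downs := by
    rcases hd with hd | hd
    · exact T.downs_subset_hull T' hd
    · exact T.downs_subset_hull_right T' hd
  have hu' := T.ups_subset_hull_right T'
  have hv' := T.downs_subset_hull_right T'
  refine ⟨_, .punctured _ (hT.hull hT') hd', h₁.trans (T.ups_subset_hull T'),
    h₂.trans (erase_subset_erase _ (T.downs_subset_hull T')), h₁'.trans hu',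
    h₂'.trans (erase_subset_erase _ hv'), ?_⟩
  rw [cost_punctured hd']
  omega

/-- If the hull acquires `d`, some sector of `d` is avoided by both triangles and can be cut off the
hull at no cost. -/
theorem IsPiece.merge_whole {n : ℕ} {d v : ℕ × ℕ} {T T' : Tri} (hT : T.Inside n)
    (hT' : T'.Inside n) (hd : d ∉ T.downs) (hd' : d ∉ T'.downs) (hv : v ∈ T.ups)
    (hv' : v ∈ T'.ups) :
    ∃ Q : Piece, IsPiece n d Q ∧ T.ups ⊆ Q.1 ∧ T.downs ⊆ Q.2 ∧ T'.ups ⊆ Q.1 ∧ T'.downs ⊆ Q.2 ∧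
      Q.cost + 1 ≤ T.size + T'.size := by
  classical
  have hsize := Tri.size_hull_of_up hv hv'
  have hu' := T.ups_subset_hull_right T'
  have hw' := T.downs_subset_hull_right T'
  by_cases hdH : d ∈ (T.hull T').downs
  · obtain ⟨σ, h, h'⟩ := Tri.exists_avoids hd hd'
    refine ⟨_, .cut _ (hT.hull hT') hdH σ, ?_, ?_, ?_, ?_, ?_⟩
    · exact fun w hw => mem_filter.2 ⟨T.ups_subset_hull T' hw, h.2 w hw⟩
    · exact fun w hw => mem_filter.2 ⟨T.downs_subset_hull T' hw, h.1 w hw⟩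
    · exact fun w hw => mem_filter.2 ⟨hu' hw, h'.2 w hw⟩
    · exact fun w hw => mem_filter.2 ⟨hw' hw, h'.1 w hw⟩
    · rw [cost_cut hdH]
      omega
  · refine ⟨_, .whole _ (hT.hull hT') hdH, T.ups_subset_hull T', T.downs_subset_hull T', hu', hw', ?_⟩
    rw [cost_whole]
    omega

-- If `T'` avoids the missing sector, the same sector is cut off the hull. If `T'` enters it, then
-- `T` and `T'` share a downward cell, and the additional unit saved pays for removing just `d`.
open scoped Classical in
theorem IsPiece.merge_cut_whole {n : ℕ} {d v : ℕ × ℕ} {T T' : Tri} {σ : Side} (hT : T.Inside n)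
    (hT' : T'.Inside n) (hd : d ∈ T.downs) (hd' : d ∉ T'.downs)
    (hv : v ∈ T.ups.filter (¬ InUpSector d σ ·)) (hv' : v ∈ T'.ups) :
    ∃ Q : Piece, IsPiece n d Q ∧ T.ups.filter (¬ InUpSector d σ ·) ⊆ Q.1 ∧
      T.downs.filter (¬ InSector d σ ·) ⊆ Q.2 ∧ T'.ups ⊆ Q.1 ∧ T'.downs ⊆ Q.2 ∧
      Q.cost + 1 ≤ T.size + T'.size := by
  have hu' := T.ups_subset_hull_right T'
  have hw' := T.downs_subset_hull_right T'
  rw [mem_filter] at hv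
  have hdH := T.downs_subset_hull T' hd
  by_cases h : ∃ w ∈ T'.ups, InUpSector d σ w
  · obtain ⟨w, hw, hwσ⟩ := h
    obtain ⟨z, hz, hz'⟩ := Tri.exists_common_down hd hd' hv.1 hv' hv.2 hw hwσ
    have hsize := Tri.size_hull_of_down hz hz'
    refine ⟨_, .punctured _ (hT.hull hT') hdH, (filter_subset _ _).trans (T.ups_subset_hull T'),
      ?_, hu', ?_, ?_⟩
    · intro z hz
      rw [mem_filter] at hz
      refine mem_erase.2 ⟨?_, T.downs_subset_hull T' hz.1⟩
      rintro rfl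
      exact hz.2 (inSector_self _ _)
    · exact fun z hz => mem_erase.2 ⟨fun h => hd' (h ▸ hz), hw' hz⟩
    · rw [cost_punctured hdH]
      omega
  · push Not at h
    have hsize := Tri.size_hull_of_up hv.1 hv'
    refine ⟨_, .cut _ (hT.hull hT') hdH σ, filter_subset_filter _ (T.ups_subset_hull T'),
      filter_subset_filter _ (T.downs_subset_hull T'), ?_, ?_, ?_⟩
    · exact fun w hw => mem_filter.2 ⟨hu' hw, h w hw⟩
    · refine fun z hz => mem_filter.2 ⟨hw' hz, fun hzσ => ?_⟩
      exact h _ (Tri.nbrs_subset_ups.2 hz (add_offset_mem_nbrs z σ)) (inUpSector_add_offset.2 hzσ)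
    · rw [cost_cut hdH]
      omega

/-- Two pieces with a common upward cell are contained in a piece of smaller total cost. -/
theorem IsPiece.merge {n : ℕ} {d v : ℕ × ℕ} {P P' : Piece} (hP : IsPiece n d P)
    (hP' : IsPiece n d P') (hv : v ∈ P.1) (hv' : v ∈ P'.1) :
    ∃ Q, IsPiece n d Q ∧ P.1 ⊆ Q.1 ∧ P.2 ⊆ Q.2 ∧ P'.1 ⊆ Q.1 ∧ P'.2 ⊆ Q.2 ∧
      Q.cost + 1 ≤ P.cost + P'.cost := by
  classical
  obtain ⟨T, hT, h₁, h₂, hc⟩ := hP.exists_tri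
  obtain ⟨T', hT', h₁', h₂', hc'⟩ := hP'.exists_tri
  have hsize := Tri.size_hull_of_up (h₁ hv) (h₁' hv')
  rcases hP with ⟨U, hU, hd⟩ | ⟨U, hU, hd, σ⟩ | ⟨U, hU, hd⟩
  · rcases hP' with ⟨U', hU', hd'⟩ | ⟨U', hU', hd', σ'⟩ | ⟨U', hU', hd'⟩
    · rw [cost_whole, cost_whole]
      exact merge_whole hU hU' hd hd' hv hv'
    · rw [cost_whole, cost_cut hd']
      obtain ⟨Q, hQ, h1, h2, h3, h4, h5⟩ := merge_cut_whole hU' hU hd' hd hv' hv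
      exact ⟨Q, hQ, h3, h4, h1, h2, by omega⟩
    -- The punctured piece costs one more than the size of its triangle; this is the second unit
    -- required by `merge_of_cost`.
    · have hsize := Tri.size_hull_of_up (h₁ hv) hv'
      refine merge_of_cost hT hU' (Or.inr hd') h₁ h₂ subset_rfl subset_rfl ?_
      rw [cost_punctured hd']
      omega
  · rcases hP' with ⟨U', hU', hd'⟩ | ⟨U', hU', hd', σ'⟩ | ⟨U', hU', hd'⟩
    · rw [cost_whole, cost_cut hd]
      exact merge_cut_whole hU hU' hd hd' hv hv'
    -- Both triangles contain `d`, so `d` itself is the common downward cell that saves two units.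
    · have hsize := Tri.size_hull_of_down hd hd'
      refine merge_of_cost hU hU' (Or.inr hd') (filter_subset _ _) ?_ (filter_subset _ _) ?_ ?_
      · intro z hz
        rw [mem_filter] at hz
        refine mem_erase.2 ⟨?_, hz.1⟩
        rintro rfl
        exact hz.2 (inSector_self _ _)
      · intro z hz
        rw [mem_filter] at hz
        refine mem_erase.2 ⟨?_, hz.1⟩
        rintro rfl
        exact hz.2 (inSector_self _ _)
      · rw [cost_cut hd, cost_cut hd']
        omega
    · have hsize := Tri.size_hull_of_up (h₁ hv) hv'
      refine merge_of_cost hT hU' (Or.inr hd') h₁ h₂ subset_rfl subset_rfl ?_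
      rw [cost_punctured hd']
      omega
  · have hsize := Tri.size_hull_of_up hv (h₁' hv')
    refine merge_of_cost hU hT' (Or.inl hd) subset_rfl subset_rfl h₁' h₂' ?_
    rw [cost_punctured hd]
    omega

/-! ### Covering a set of downward cells by pieces -/

open scoped Classical in
/-- A piece can be added to a family of disjoint pieces, if it is merged with those it meets. -/
theorem exists_insert_piece {n : ℕ} {d : ℕ × ℕ} (F : Finset Piece) (P : Piece)
    (hF : ∀ Q ∈ F, IsPiece n d Q) (hP : IsPiece n d P)
    (hdisj : ∀ Q ∈ F, ∀ R ∈ F, Q ≠ R → Disjoint Q.1 R.1) :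
    ∃ F' : Finset Piece, (∀ Q ∈ F', IsPiece n d Q) ∧
      (∀ Q ∈ F', ∀ R ∈ F', Q ≠ R → Disjoint Q.1 R.1) ∧
      (∀ Q ∈ insert P F, ∃ R ∈ F', Q.1 ⊆ R.1 ∧ Q.2 ⊆ R.2) ∧
      ∑ Q ∈ F', Q.cost + (F.filter fun Q => ¬ Disjoint P.1 Q.1).card ≤
        ∑ Q ∈ F, Q.cost + P.cost := by
  induction hk : F.card generalizing F P with
  | zero =>
    rw [card_eq_zero] at hk
    subst hk
    exact ⟨{P}, by simpa using hP, by simp, by simp, by simp⟩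
  | succ k ih =>
    by_cases h : ∃ Q ∈ F, ¬ Disjoint P.1 Q.1
    · obtain ⟨Q, hQF, hPQ⟩ := h
      obtain ⟨v, hv, hv'⟩ := not_disjoint_iff.1 hPQ
      obtain ⟨R, hR, h1, h2, h3, h4, h5⟩ := hP.merge (hF Q hQF) hv hv'
      obtain ⟨F', hF', hdisj', hsub, hcost⟩ := ih (F.erase Q) R
        (fun A hA => hF A (mem_of_mem_erase hA)) hR
        (fun A hA B hB => hdisj A (mem_of_mem_erase hA) B (mem_of_mem_erase hB))
        (by rw [card_erase_of_mem hQF, hk]; rfl)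
      obtain ⟨R', hR', hRR', hRR''⟩ := hsub R (mem_insert_self _ _)
      refine ⟨F', hF', hdisj', ?_, ?_⟩
      · intro A hA
        by_cases hAQ : A = Q
        · subst hAQ
          exact ⟨R', hR', h3.trans hRR', h4.trans hRR''⟩
        rcases mem_insert.1 hA with rfl | hA
        · exact ⟨R', hR', h1.trans hRR', h2.trans hRR''⟩
        · exact hsub A (mem_insert_of_mem (mem_erase.2 ⟨hAQ, hA⟩))
      · have hsum := add_sum_erase F Piece.cost hQF
        -- The pieces that meet `P` also meet the larger `R`. Only `Q` is lost from the count, and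
        -- merging with `Q` has already saved one unit.
        have hcard : (F.filter fun A => ¬ Disjoint P.1 A.1).card ≤
            ((F.erase Q).filter fun A => ¬ Disjoint R.1 A.1).card + 1 := by
          rw [← card_erase_add_one (show Q ∈ F.filter fun A => ¬ Disjoint P.1 A.1 from
            mem_filter.2 ⟨hQF, hPQ⟩)]
          refine Nat.add_le_add_right (card_le_card fun A hA => ?_) 1
          rw [mem_erase, mem_filter] at hA
          exact mem_filter.2 ⟨mem_erase.2 ⟨hA.1, hA.2.1⟩, fun h => hA.2.2 (h.mono_left h1)⟩
        omega
    · push Not at h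
      have hPF : P ∉ F := fun hPF => by
        obtain ⟨v, hv⟩ := hP.nonempty
        exact Finset.disjoint_left.1 (h P hPF) hv hv
      refine ⟨insert P F, ?_, ?_, fun Q hQ => ⟨Q, hQ, subset_rfl, subset_rfl⟩, ?_⟩
      · intro Q hQ
        rcases mem_insert.1 hQ with rfl | hQ
        exacts [hP, hF Q hQ]
      · intro Q hQ R hR hne
        rcases mem_insert.1 hQ with hQ | hQ <;> rcases mem_insert.1 hR with hR | hR
        · exact absurd (hQ.trans hR.symm) hne
        · exact hQ ▸ h R hR
        · exact hR ▸ (h Q hQ).symm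
        · exact hdisj Q hQ R hR hne
      · rw [filter_false_of_mem (by simpa using h), sum_insert hPF, card_empty]
        push_cast
        linarith

/-- A finite set of downward cells is contained in disjoint pieces whose cost is at most the number
of its neighbours minus its cardinality. -/
theorem exists_pieces {n : ℕ} {d : ℕ × ℕ} (Z : Finset (ℕ × ℕ)) (hZ : Z ⊆ (big n).downs)
    (hd : d ∉ Z) :
    ∃ F : Finset Piece, (∀ P ∈ F, IsPiece n d P) ∧
      (∀ P ∈ F, ∀ Q ∈ F, P ≠ Q → Disjoint P.1 Q.1) ∧ (∀ z ∈ Z, ∃ P ∈ F, z ∈ P.2) ∧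
      ∑ P ∈ F, P.cost + Z.card ≤ (Z.biUnion nbrs).card := by
  classical
  -- The cells are added in the order of their height, so the neighbour on top of the new cell is
  -- not a neighbour of an earlier one.
  induction Z using induction_on_max_value (fun z : ℕ × ℕ => z.2) with
  | empty => exact ⟨∅, by simp⟩
  | insert z s hzs hmax ih =>
    obtain ⟨F, hF, hdisj, hcov, hcost⟩ := ih ((subset_insert _ _).trans hZ)
      fun h => hd (mem_insert_of_mem h)
    have hzd : z ≠ d := by
      rintro rfl
      exact hd (mem_insert_self _ _)
    have hzn : z.1 + z.2 + 1 < n := by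
      have := Tri.mem_downs.1 (hZ (mem_insert_self z s))
      simp only [big] at this
      omega
    have hcovN : ∀ v ∈ s.biUnion nbrs, ∃ P ∈ F, v ∈ P.1 := by
      intro v hv
      obtain ⟨w, hw, hv⟩ := mem_biUnion.1 hv
      obtain ⟨P, hP, hwP⟩ := hcov w hw
      exact ⟨P, hP, (hF P hP).nbrs_subset hwP hv⟩
    have hcard : ((insert z s).biUnion nbrs).card =
        (s.biUnion nbrs).card + (nbrs z \ s.biUnion nbrs).card := by
      rw [biUnion_insert, union_comm, card_union]
      have := card_sdiff_add_card_inter (nbrs z) (s.biUnion nbrs)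
      rw [inter_comm]
      omega
    have hj := card_sdiff_add_card_inter (nbrs z) (s.biUnion nbrs)
    rw [card_nbrs] at hj
    have htop : (nbrs z \ s.biUnion nbrs).Nonempty := by
      refine ⟨(z.1, z.2 + 1), mem_sdiff.2 ⟨by simp [nbrs], fun h => ?_⟩⟩
      obtain ⟨w, hw, hv⟩ := mem_biUnion.1 h
      have h1 := hmax w hw
      have h2 : w ≠ z := fun h => hzs (h ▸ hw)
      rw [Ne, Prod.ext_iff] at h2
      rw [mem_nbrs] at hv
      simp only at hv
      omega
    rw [← card_pos] at htop
    rw [card_insert_of_notMem hzs, hcard]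
    -- If `z` is already covered, the family can stay: there is at least one new neighbour, so
    -- `|N(Z)| - |Z|` does not decrease. Otherwise a piece of cost `3 - 1` is inserted. With `j` old
    -- neighbours, the bound grows by only `(3 - j) - 1`, but the old neighbours lie in `j`
    -- different pieces, each of which saves a unit when merged.
    by_cases hzF : ∃ P ∈ F, z ∈ P.2
    · refine ⟨F, hF, hdisj, ?_, by push_cast; omega⟩
      intro w hw
      rcases mem_insert.1 hw with rfl | hw
      exacts [hzF, hcov w hw]
    · obtain ⟨F', hF', hdisj', hsub, hcost'⟩ :=
        exists_insert_piece F (nbrs z, {z}) hF (isPiece_nbrs hzn hzd) hdisj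
      refine ⟨F', hF', hdisj', ?_, ?_⟩
      · intro w hw
        rcases mem_insert.1 hw with rfl | hw
        · obtain ⟨R, hR, -, h⟩ := hsub _ (mem_insert_self _ _)
          exact ⟨R, hR, h (mem_singleton_self _)⟩
        · obtain ⟨P, hP, hwP⟩ := hcov w hw
          obtain ⟨R, hR, -, h⟩ := hsub P (mem_insert_of_mem hP)
          exact ⟨R, hR, h hwP⟩
      · have hq : (nbrs z ∩ s.biUnion nbrs).card ≤
            (F.filter fun Q => ¬ Disjoint (nbrs z) Q.1).card := by
          choose! f hf using hcovN
          refine card_le_card_of_injOn f (fun v hv => ?_) fun v hv w hw hvw => ?_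
          · rw [mem_coe, mem_inter] at hv
            exact mem_filter.2 ⟨(hf v hv.2).1, not_disjoint_iff.2 ⟨v, hv.1, (hf v hv.2).2⟩⟩
          · rw [mem_coe, mem_inter] at hv hw
            by_contra hne
            have h1 := hf v hv.2
            have h2 := hf w hw.2
            rw [← hvw] at h2
            exact hzF ⟨f v, h1.1, (hF _ h1.1).mem_of_two hzd hv.1 hw.1 hne h1.2 h2.2⟩
        simp only [Piece.cost, card_nbrs, card_singleton] at hcost' hcost ⊢
        push_cast at hcost' ⊢
        omega

/-! ### Holes -/

/-- The upward cells covered by the holes. -/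
def holeUps (S : Finset Tri) : Finset (ℕ × ℕ) := S.biUnion Tri.ups

/-- The downward cells covered by the holes. -/
def holeDowns (S : Finset Tri) : Finset (ℕ × ℕ) := S.biUnion Tri.downs

theorem up_mem_cells {T : Tri} {v : ℕ × ℕ} : Cell.up v.1 v.2 ∈ T.cells ↔ v ∈ T.ups := by
  rw [Tri.mem_ups]
  rfl

theorem down_mem_cells {T : Tri} {z : ℕ × ℕ} : Cell.down z.1 z.2 ∈ T.cells ↔ z ∈ T.downs := by
  rw [Tri.mem_downs]
  rfl

theorem up_mem_holeCells {S : Finset Tri} {v : ℕ × ℕ} :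
    Cell.up v.1 v.2 ∈ holeCells S ↔ v ∈ holeUps S := by
  simp only [holeUps, mem_biUnion, ← up_mem_cells]
  rfl

theorem down_mem_holeCells {S : Finset Tri} {z : ℕ × ℕ} :
    Cell.down z.1 z.2 ∈ holeCells S ↔ z ∈ holeDowns S := by
  simp only [holeDowns, mem_biUnion, ← down_mem_cells]
  rfl

theorem up_mem_region {n : ℕ} {S : Finset Tri} {v : ℕ × ℕ} :
    Cell.up v.1 v.2 ∈ region n S ↔ v ∈ (big n).ups \ holeUps S := by
  rw [mem_sdiff, ← up_mem_cells, ← up_mem_holeCells]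
  rfl

theorem down_mem_region {n : ℕ} {S : Finset Tri} {z : ℕ × ℕ} :
    Cell.down z.1 z.2 ∈ region n S ↔ z ∈ (big n).downs \ holeDowns S := by
  rw [mem_sdiff, ← down_mem_cells, ← down_mem_holeCells]
  rfl

theorem nbrs_subset_holeUps {S : Finset Tri} {z : ℕ × ℕ} (hz : z ∈ holeDowns S) :
    nbrs z ⊆ holeUps S := by
  obtain ⟨s, hs, hz⟩ := mem_biUnion.1 hz
  exact (Tri.nbrs_subset_ups.2 hz).trans (subset_biUnion_of_mem Tri.ups hs)

theorem IsArrangement.disjoint_ups {n : ℕ} {S : Finset Tri} (h : IsArrangement n S) {s t : Tri}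
    (hs : s ∈ S) (ht : t ∈ S) (hst : s ≠ t) : Disjoint s.ups t.ups := by
  rw [Finset.disjoint_left]
  intro v hv hv'
  exact Set.disjoint_left.1 (h.disjoint s hs t ht hst) (up_mem_cells.2 hv) (up_mem_cells.2 hv')

theorem IsArrangement.disjoint_downs {n : ℕ} {S : Finset Tri} (h : IsArrangement n S) {s t : Tri}
    (hs : s ∈ S) (ht : t ∈ S) (hst : s ≠ t) : Disjoint s.downs t.downs := by
  rw [Finset.disjoint_left]
  intro v hv hv'
  exact Set.disjoint_left.1 (h.disjoint s hs t ht hst) (down_mem_cells.2 hv) (down_mem_cells.2 hv')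

theorem Tri.ups_inter (s T : Tri) : (s.inter T).ups = s.ups ∩ T.ups := by
  ext v
  simp only [mem_inter, Tri.mem_ups, Tri.inter]
  omega

theorem Tri.downs_inter (s T : Tri) : (s.inter T).downs = s.downs ∩ T.downs := by
  ext v
  simp only [mem_inter, Tri.mem_downs, Tri.inter]
  omega

/-- The surplus of upward cells over downward cells in the part of a triangle outside the holes. -/
theorem IsArrangement.card_ups_sdiff {n : ℕ} {S : Finset Tri} (h : IsArrangement n S) (T : Tri) :
    (T.ups \ holeUps S).card + ∑ s ∈ S, (s.inter T).size =
      (T.downs \ holeDowns S).card + T.size := by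
  have h1 : (T.ups ∩ holeUps S).card = ∑ s ∈ S, (s.inter T).ups.card := by
    rw [holeUps, inter_biUnion, card_biUnion]
    · simp only [Tri.ups_inter, inter_comm]
    · exact fun s hs t ht hst =>
        (h.disjoint_ups hs ht hst).mono inter_subset_right inter_subset_right
  have h2 : (T.downs ∩ holeDowns S).card = ∑ s ∈ S, (s.inter T).downs.card := by
    rw [holeDowns, inter_biUnion, card_biUnion]
    · simp only [Tri.downs_inter, inter_comm]
    · exact fun s hs t ht hst =>
        (h.disjoint_downs hs ht hst).mono inter_subset_right inter_subset_right
  simp only [Tri.card_ups, sum_add_distrib] at h1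
  have h3 := card_sdiff_add_card_inter T.ups (holeUps S)
  have h4 := card_sdiff_add_card_inter T.downs (holeDowns S)
  have h5 := T.card_ups
  omega

theorem Tri.inter_big {n : ℕ} {s : Tri} (hs : s.Inside n) : (s.inter (big n)).size = s.size := by
  simp only [Tri.Inside] at hs
  simp only [Tri.inter, big]
  omega

theorem IsArrangement.sum_inter_big {n : ℕ} {S : Finset Tri} (h : IsArrangement n S) :
    ∑ s ∈ S, (s.inter (big n)).size = (big n).size := by
  rw [sum_congr rfl fun s hs => Tri.inter_big (h.inside s hs), h.sum_size]
  rfl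

theorem IsArrangement.saturated_big {n : ℕ} {S : Finset Tri} (h : IsArrangement n S)
    (hn : 0 < n) : Saturated n S (big n) :=
  ⟨⟨hn, by simp [big]⟩, h.sum_inter_big⟩

theorem IsArrangement.saturated_hole {n : ℕ} {S : Finset Tri} (h : IsArrangement n S)
    (hS : SpreadOut n S) {s : Tri} (hs : s ∈ S) : Saturated n S s := by
  refine ⟨h.inside s hs, le_antisymm (hS s (h.inside s hs)) ?_⟩
  have h1 : (s.inter s).size = s.size := by
    simp only [Tri.inter]
    omega
  calc s.size = (s.inter s).size := h1.symm
    _ ≤ _ := single_le_sum (f := fun t : Tri => (t.inter s).size) (fun _ _ => Nat.zero_le _) hs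

/-- Saturation as a balance of free cells, which is the form used with matchings. -/
theorem IsArrangement.saturated_iff {n : ℕ} {S : Finset Tri} (h : IsArrangement n S) {T : Tri} :
    Saturated n S T ↔
      T.Inside n ∧ (T.ups \ holeUps S).card = (T.downs \ holeDowns S).card := by
  have := h.card_ups_sdiff T
  rw [Saturated]
  refine and_congr_right fun _ => ?_
  omega

theorem IsArrangement.card_downs_le {n : ℕ} {S : Finset Tri} (h : IsArrangement n S)
    (hS : SpreadOut n S) {T : Tri} (hT : T.Inside n) :
    (T.downs \ holeDowns S).card ≤ (T.ups \ holeUps S).card := by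
  have := h.card_ups_sdiff T
  have := hS T hT
  omega

/-! ### Matchings -/

/-- Hall's condition for arbitrary sets follows from the condition for pieces. -/
theorem card_le_card_nbrs_sdiff {n : ℕ} {S : Finset Tri} {d u : ℕ × ℕ}
    (h : IsArrangement n S) (hd : d ∉ holeDowns S)
    (hpiece : ∀ P, IsPiece n d P →
      (P.2 \ holeDowns S).card ≤ (P.1 \ insert u (holeUps S)).card)
    {X : Finset (ℕ × ℕ)} (hX : X ⊆ (big n).downs \ holeDowns S) (hdX : d ∉ X) :
    X.card ≤ (X.biUnion nbrs \ insert u (holeUps S)).card := by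
  classical
  have hHn : holeDowns S ⊆ (big n).downs := by
    intro z hz
    obtain ⟨s, hs, hz⟩ := mem_biUnion.1 hz
    have := h.inside s hs
    simp only [Tri.Inside] at this
    rw [Tri.mem_downs] at hz ⊢
    simp only [big]
    omega
  -- Adding the hole cells to `X` makes every cell of the cover outside `Z` a free cell. It does no
  -- harm, since neighbours of hole cells are hole cells and are discarded with `B`.
  obtain ⟨F, hF, hdisj, hcov, hcost⟩ := exists_pieces (n := n) (d := d) (X ∪ holeDowns S)
    (union_subset (hX.trans sdiff_subset) hHn) (by simp [hd, hdX])
  set Z := X ∪ holeDowns S with hZ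
  set B := insert u (holeUps S) with hB
  have hdisj' : ∀ P ∈ F, ∀ Q ∈ F, P ≠ Q → Disjoint P.2 Q.2 := by
    intro P hP Q hQ hPQ
    rw [Finset.disjoint_left]
    intro z hz hz'
    exact Finset.disjoint_left.1 (hdisj P hP Q hQ hPQ)
      ((hF P hP).nbrs_subset hz (add_offset_mem_nbrs z .right))
      ((hF Q hQ).nbrs_subset hz' (add_offset_mem_nbrs z .right))
  set U := F.biUnion Prod.fst with hU
  set V := F.biUnion Prod.snd with hV
  have hUcard : U.card = ∑ P ∈ F, P.1.card := card_biUnion hdisj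
  have hVcard : V.card = ∑ P ∈ F, P.2.card := card_biUnion hdisj'
  have hsdiff : ∀ (g : Piece → Finset (ℕ × ℕ)) (C : Finset (ℕ × ℕ)),
      F.biUnion g \ C = F.biUnion fun P => g P \ C := by
    intro g C
    ext v
    simp only [mem_sdiff, mem_biUnion]
    exact ⟨fun ⟨⟨P, hP, h⟩, h'⟩ => ⟨P, hP, h, h'⟩, fun ⟨P, hP, h, h'⟩ => ⟨⟨P, hP, h⟩, h'⟩⟩
  have hUB : (U \ B).card = ∑ P ∈ F, (P.1 \ B).card := by
    rw [hU, hsdiff, card_biUnion]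
    exact fun P hP Q hQ hPQ => (hdisj P hP Q hQ hPQ).mono sdiff_subset sdiff_subset
  have hVH : (V \ holeDowns S).card = ∑ P ∈ F, (P.2 \ holeDowns S).card := by
    rw [hV, hsdiff, card_biUnion]
    exact fun P hP Q hQ hPQ => (hdisj' P hP Q hQ hPQ).mono sdiff_subset sdiff_subset
  have hle : (V \ holeDowns S).card ≤ (U \ B).card := by
    rw [hUB, hVH]
    exact sum_le_sum fun P hP => hpiece P (hF P hP)
  have hZV : Z ⊆ V := fun z hz => by
    obtain ⟨P, hP, hzP⟩ := hcov z hz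
    exact mem_biUnion.2 ⟨P, hP, hzP⟩
  have hNU : Z.biUnion nbrs ⊆ U := by
    intro v hv
    obtain ⟨z, hz, hv⟩ := mem_biUnion.1 hv
    obtain ⟨P, hP, hzP⟩ := hcov z hz
    exact mem_biUnion.2 ⟨P, hP, (hF P hP).nbrs_subset hzP hv⟩
  have hcost' : U.card + Z.card ≤ (Z.biUnion nbrs).card + V.card := by
    simp only [Piece.cost, sum_sub_distrib] at hcost
    rw [hUcard, hVcard]
    zify
    linarith
  have hNB : Z.biUnion nbrs \ B ⊆ X.biUnion nbrs \ B := by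
    intro v hv
    rw [mem_sdiff] at hv ⊢
    refine ⟨?_, hv.2⟩
    obtain ⟨z, hz, hvz⟩ := mem_biUnion.1 hv.1
    rcases mem_union.1 hz with hz | hz
    · exact mem_biUnion.2 ⟨z, hz, hvz⟩
    · exact absurd (mem_insert_of_mem (nbrs_subset_holeUps hz hvz)) hv.2
  have h1 := card_le_card hNB
  have h2 : (U \ B).card ≤ (Z.biUnion nbrs \ B).card + (U \ Z.biUnion nbrs).card := by
    rw [← card_union_of_disjoint]
    · refine card_le_card fun v hv => ?_
      rw [mem_sdiff] at hv
      by_cases hvN : v ∈ Z.biUnion nbrs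
      · exact mem_union_left _ (mem_sdiff.2 ⟨hvN, hv.2⟩)
      · exact mem_union_right _ (mem_sdiff.2 ⟨hv.1, hvN⟩)
    · exact disjoint_sdiff.mono_left sdiff_subset
  have h3 := card_sdiff_add_card_eq_card hNU
  have h4 := card_sdiff_add_card_eq_card hZV
  have h5 := card_sdiff_add_card_eq_card (show holeDowns S ⊆ Z from subset_union_right)
  have h6 := card_sdiff_add_card_eq_card ((show holeDowns S ⊆ Z from subset_union_right).trans hZV)
  have h7 : Z \ holeDowns S = X := by
    ext z
    simp only [hZ, mem_sdiff, mem_union]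
    have := fun hz : z ∈ X => (mem_sdiff.1 (hX hz)).2
    tauto
  rw [h7] at h5
  -- With `H = holeDowns S` and `N` for neighbours: `|X| + |V \ Z| = |V \ H| ≤ |U \ B| ≤ |N(Z) \ B|
  -- + |U \ N(Z)| ≤ |N(X) \ B| + |V \ Z|`. The last step uses the cost bound on the cover.
  omega

/-- A matching of the downward cells outside the holes that sends `d` to `u`. -/
theorem exists_matching {n : ℕ} {S : Finset Tri} {d u : ℕ × ℕ}
    (h : IsArrangement n S) (hd : d ∉ holeDowns S)
    (hdu : d ∈ (big n).downs → u ∈ nbrs d ∧ u ∉ holeUps S)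
    (hpiece : ∀ P, IsPiece n d P →
      (P.2 \ holeDowns S).card ≤ (P.1 \ insert u (holeUps S)).card) :
    ∃ φ : ℕ × ℕ → ℕ × ℕ, Set.InjOn φ ↑((big n).downs \ holeDowns S) ∧
      (∀ z ∈ (big n).downs \ holeDowns S, φ z ∈ nbrs z ∧ φ z ∉ holeUps S) ∧
      (d ∈ (big n).downs → φ d = u) := by
  classical
  set D := (big n).downs \ holeDowns S with hD
  -- The cell `u` is reserved for `d` by withholding it from all other cells.
  let t : D → Finset (ℕ × ℕ) := fun z =>
    if z.1 = d then {u} else nbrs z.1 \ insert u (holeUps S)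
  have hall : ∀ X : Finset D, X.card ≤ (X.biUnion t).card := by
    intro X
    set Y := (X.map (Function.Embedding.subtype _)).erase d with hY
    have hYD : Y ⊆ D := by
      intro z hz
      obtain ⟨w, -, rfl⟩ := mem_map.1 (mem_of_mem_erase hz)
      exact w.2
    have hYc := card_le_card_nbrs_sdiff h hd hpiece hYD (notMem_erase d _)
    have hYt : Y.biUnion nbrs \ insert u (holeUps S) ⊆ X.biUnion t := by
      intro v hv
      rw [mem_sdiff] at hv
      obtain ⟨z, hz, hvz⟩ := mem_biUnion.1 hv.1
      obtain ⟨w, hw, rfl⟩ := mem_map.1 (mem_of_mem_erase hz)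
      refine mem_biUnion.2 ⟨w, hw, ?_⟩
      have : w.1 ≠ d := ne_of_mem_erase hz
      simp only [t, if_neg this]
      exact mem_sdiff.2 ⟨hvz, hv.2⟩
    by_cases hdX : d ∈ X.map (Function.Embedding.subtype _)
    · have h1 := card_erase_add_one hdX
      rw [card_map, ← hY] at h1
      obtain ⟨w, hw, hwd⟩ := mem_map.1 hdX
      have hu : u ∈ X.biUnion t := by
        refine mem_biUnion.2 ⟨w, hw, ?_⟩
        have : w.1 = d := hwd
        simp [t, this]
      have h2 : insert u (Y.biUnion nbrs \ insert u (holeUps S)) ⊆ X.biUnion t :=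
        insert_subset hu hYt
      have h3 := card_le_card h2
      rw [card_insert_of_notMem (by simp)] at h3
      omega
    · have h1 : Y.card = X.card := by rw [hY, erase_eq_of_notMem hdX, card_map]
      have h2 := card_le_card hYt
      omega
  obtain ⟨f, hf, hft⟩ := (Finset.all_card_le_biUnion_card_iff_exists_injective t).1 hall
  refine ⟨fun z => if hz : z ∈ D then f ⟨z, hz⟩ else z, ?_, ?_, ?_⟩
  · intro z hz w hw hzw
    rw [mem_coe] at hz hw
    simp only [dif_pos hz, dif_pos hw] at hzw
    simpa using hf hzw
  · intro z hz
    have h1 := hft ⟨z, hz⟩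
    simp only [dif_pos hz]
    by_cases hzd : z = d
    · subst hzd
      simp only [t, if_true, mem_singleton] at h1
      rw [h1]
      exact hdu (mem_sdiff.1 hz).1
    · simp only [t, if_neg hzd, mem_sdiff, mem_insert, not_or] at h1
      exact ⟨h1.1, h1.2.2⟩
  · intro hdn
    have hdD : d ∈ D := mem_sdiff.2 ⟨hdn, hd⟩
    have h1 := hft ⟨d, hdD⟩
    simp only [t, if_true, mem_singleton] at h1
    simpa only [dif_pos hdD] using h1

/-! ### Segments and rhombi -/

/-- The position of the upward cell that a segment belongs to. -/
def Segment.pos (e : Segment) : ℕ × ℕ := (e.x, e.y)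

/-- The position of the downward half of a rhombus. -/
def Rhombus.down (r : Rhombus) : ℕ × ℕ := (r.x, r.y)

/-- The position of the upward half of a rhombus. -/
def Rhombus.up (r : Rhombus) : ℕ × ℕ := r.down + r.side.offset

theorem Side.offset_injective : Function.Injective Side.offset := by
  intro s t h
  cases s <;> cases t <;> simp [Side.offset] at h <;> rfl

theorem Rhombus.upCell_eq (r : Rhombus) : r.upCell = .up r.up.1 r.up.2 := by
  obtain ⟨x, y, s⟩ := r
  cases s <;> rfl

theorem Rhombus.diagonal_eq (r : Rhombus) : r.diagonal = ⟨r.up.1, r.up.2, r.side⟩ := by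
  obtain ⟨x, y, s⟩ := r
  cases s <;> rfl

theorem Rhombus.downCell_eq (r : Rhombus) : r.downCell = .down r.down.1 r.down.2 := rfl

theorem Rhombus.ext_down {r r' : Rhombus} (h : r.down = r'.down) (h' : r.side = r'.side) :
    r = r' := by
  rw [Rhombus.down, Rhombus.down, Prod.ext_iff] at h
  exact Rhombus.ext h.1 h.2 h'

theorem Rhombus.ext_down_up {r r' : Rhombus} (h : r.down = r'.down) (h' : r.up = r'.up) :
    r = r' := by
  refine Rhombus.ext_down h (Side.offset_injective ?_)
  rw [Rhombus.up, Rhombus.up, h] at h'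
  exact add_left_cancel h'

theorem Rhombus.up_mem_nbrs (r : Rhombus) : r.up ∈ nbrs r.down := add_offset_mem_nbrs _ _

theorem mem_sides_up {e : Segment} {a b : ℕ} : e ∈ (Cell.up a b).sides ↔ e.pos = (a, b) := by
  obtain ⟨x, y, s⟩ := e
  cases s <;> simp [Cell.sides, Segment.pos]

theorem mem_sides_down {e : Segment} {a b : ℕ} :
    e ∈ (Cell.down a b).sides ↔ e.pos = (a, b) + e.side.offset := by
  obtain ⟨x, y, s⟩ := e
  cases s <;> simp [Cell.sides, Segment.pos, Side.offset]

theorem Rhombus.mem_boundary {r : Rhombus} {e : Segment} : e ∈ boundary r.cells ↔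
    (e.pos = r.up ∨ e.pos = r.down + e.side.offset) ∧
      ¬ (e.pos = r.up ∧ e.pos = r.down + e.side.offset) := by
  have hu : e ∈ r.upCell.sides ↔ e.pos = r.up := by
    rw [r.upCell_eq, mem_sides_up]
  have hd : e ∈ r.downCell.sides ↔ e.pos = r.down + e.side.offset := by
    rw [r.downCell_eq, mem_sides_down]
  have hne : r.upCell ≠ r.downCell := by
    rw [r.upCell_eq, r.downCell_eq]
    simp
  rw [← hu, ← hd]
  constructor
  · rintro ⟨c, ⟨hc, hec⟩, huniq⟩
    refine ⟨?_, fun ⟨h1, h2⟩ => hne ?_⟩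
    · rcases hc with rfl | rfl
      exacts [Or.inl hec, Or.inr hec]
    · exact (huniq _ ⟨Or.inl rfl, h1⟩).trans (huniq _ ⟨Or.inr rfl, h2⟩).symm
  · rintro ⟨h1 | h1, h2⟩
    · refine ⟨_, ⟨Or.inl rfl, h1⟩, ?_⟩
      rintro c ⟨rfl | rfl, hc'⟩
      exacts [rfl, absurd ⟨h1, hc'⟩ h2]
    · refine ⟨_, ⟨Or.inr rfl, h1⟩, ?_⟩
      rintro c ⟨rfl | rfl, hc'⟩
      exacts [absurd ⟨hc', h1⟩ h2, rfl]

theorem Tri.mem_boundary {T : Tri} {e : Segment} : e ∈ boundary T.cells ↔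
    e.pos ∈ T.ups ∧ ∀ z ∈ T.downs, e.pos ≠ z + e.side.offset := by
  constructor
  · rintro ⟨c, ⟨hc, hec⟩, huniq⟩
    have hup : e.pos ∈ T.ups := by
      cases c with
      | up a b =>
        rw [mem_sides_up] at hec
        rw [hec]
        exact up_mem_cells.1 hc
      | down a b =>
        rw [mem_sides_down] at hec
        rw [hec]
        exact Tri.nbrs_subset_ups.2 (down_mem_cells.1 hc) (add_offset_mem_nbrs (a, b) _)
    refine ⟨hup, fun z hz hez => ?_⟩
    have h1 := huniq (.up e.pos.1 e.pos.2) ⟨up_mem_cells.2 hup, mem_sides_up.2 rfl⟩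
    have h2 := huniq (.down z.1 z.2) ⟨down_mem_cells.2 hz, mem_sides_down.2 hez⟩
    rw [← h2] at h1
    cases h1
  · rintro ⟨h1, h2⟩
    refine ⟨.up e.pos.1 e.pos.2, ⟨up_mem_cells.2 h1, mem_sides_up.2 rfl⟩, ?_⟩
    rintro (⟨a, b⟩ | ⟨a, b⟩) ⟨hc, hec⟩
    · rw [mem_sides_up] at hec
      rw [hec]
    · exact absurd (mem_sides_down.1 hec) (h2 (a, b) (down_mem_cells.1 hc))

theorem Tri.mem_interiorSegments {T : Tri} {e : Segment} : e ∈ interiorSegments T.cells ↔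
    ∃ z ∈ T.downs, e.pos = z + e.side.offset := by
  constructor
  · rintro ⟨c, hc, c', hc', hne, hec, hec'⟩
    rcases c with ⟨a, b⟩ | ⟨a, b⟩
    · rcases c' with ⟨a', b'⟩ | ⟨a', b'⟩
      · rw [mem_sides_up] at hec hec'
        rw [hec, Prod.ext_iff] at hec'
        exact absurd (congrArg₂ Cell.up hec'.1 hec'.2) hne
      · exact ⟨(a', b'), down_mem_cells.1 hc', mem_sides_down.1 hec'⟩
    · exact ⟨(a, b), down_mem_cells.1 hc, mem_sides_down.1 hec⟩
  · rintro ⟨z, hz, hez⟩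
    refine ⟨.down z.1 z.2, down_mem_cells.2 hz, .up e.pos.1 e.pos.2, ?_, by simp,
      mem_sides_down.2 hez, mem_sides_up.2 rfl⟩
    rw [hez]
    exact up_mem_cells.2 (Tri.nbrs_subset_ups.2 hz (add_offset_mem_nbrs z _))

theorem up_mem_rhombus {r : Rhombus} {v : ℕ × ℕ} : Cell.up v.1 v.2 ∈ r.cells ↔ v = r.up := by
  simp [Rhombus.cells, r.upCell_eq, r.downCell_eq, Prod.ext_iff]

theorem down_mem_rhombus {r : Rhombus} {z : ℕ × ℕ} :
    Cell.down z.1 z.2 ∈ r.cells ↔ z = r.down := by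
  simp [Rhombus.cells, r.upCell_eq, r.downCell_eq, Prod.ext_iff]

theorem IsTiling.up_mem {n : ℕ} {S : Finset Tri} {R : Set Rhombus} (hR : IsTiling n S R)
    {r : Rhombus} (hr : r ∈ R) : r.up ∈ (big n).ups \ holeUps S :=
  up_mem_region.1 (hR.subset_region r hr (up_mem_rhombus.2 rfl))

theorem IsTiling.down_mem {n : ℕ} {S : Finset Tri} {R : Set Rhombus} (hR : IsTiling n S R)
    {r : Rhombus} (hr : r ∈ R) : r.down ∈ (big n).downs \ holeDowns S :=
  down_mem_region.1 (hR.subset_region r hr (down_mem_rhombus.2 rfl))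

theorem IsTiling.eq_of_up_eq {n : ℕ} {S : Finset Tri} {R : Set Rhombus} (hR : IsTiling n S R)
    {r r' : Rhombus} (hr : r ∈ R) (hr' : r' ∈ R) (h : r.up = r'.up) : r = r' :=
  (hR.covers _ (up_mem_region.2 (hR.up_mem hr))).unique ⟨hr, up_mem_rhombus.2 rfl⟩
    ⟨hr', up_mem_rhombus.2 h⟩

theorem IsTiling.eq_of_down_eq {n : ℕ} {S : Finset Tri} {R : Set Rhombus} (hR : IsTiling n S R)
    {r r' : Rhombus} (hr : r ∈ R) (hr' : r' ∈ R) (h : r.down = r'.down) : r = r' :=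
  (hR.covers _ (down_mem_region.2 (hR.down_mem hr))).unique ⟨hr, down_mem_rhombus.2 rfl⟩
    ⟨hr', down_mem_rhombus.2 h⟩

/-- A matching of the downward cells yields a tiling. -/
theorem isTiling_of_matching {n : ℕ} {S : Finset Tri} (h : IsArrangement n S)
    {φ : ℕ × ℕ → ℕ × ℕ} (hinj : Set.InjOn φ ↑((big n).downs \ holeDowns S))
    (hφ : ∀ z ∈ (big n).downs \ holeDowns S, φ z ∈ nbrs z ∧ φ z ∉ holeUps S) :
    IsTiling n S {r | r.down ∈ (big n).downs \ holeDowns S ∧ r.up = φ r.down} := by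
  have hmaps : ∀ z ∈ (big n).downs \ holeDowns S, φ z ∈ (big n).ups \ holeUps S := fun z hz =>
    mem_sdiff.2 ⟨Tri.nbrs_subset_ups.2 (mem_sdiff.1 hz).1 (hφ z hz).1, (hφ z hz).2⟩
  -- Since the hole sizes sum to `n`, the whole region is balanced, and an injective matching is
  -- also onto.
  have hcard : ((big n).ups \ holeUps S).card = ((big n).downs \ holeDowns S).card := by
    have h1 := h.card_ups_sdiff (big n)
    have h2 := h.sum_inter_big
    omega
  have hrh : ∀ z ∈ (big n).downs \ holeDowns S, ∃ r : Rhombus, r.down = z ∧ r.up = φ z := by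
    intro z hz
    obtain ⟨σ, hσ⟩ := mem_nbrs_iff_offset.1 (hφ z hz).1
    exact ⟨⟨z.1, z.2, σ⟩, rfl, hσ.symm⟩
  constructor
  · rintro r ⟨hr, hr'⟩ c (rfl | rfl)
    · rw [r.upCell_eq, up_mem_region, hr']
      exact hmaps _ hr
    · exact down_mem_region.2 hr
  · rintro (⟨a, b⟩ | ⟨a, b⟩) hc
    · obtain ⟨z, hz, hzv⟩ := surj_on_of_inj_on_of_card_le (s := (big n).downs \ holeDowns S)
        (t := (big n).ups \ holeUps S) (fun z _ => φ z) hmaps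
        (fun z w hz hw hzw => hinj hz hw hzw) hcard.le (a, b) (up_mem_region.1 hc)
      obtain ⟨r, hr, hr'⟩ := hrh z hz
      refine ⟨r, ⟨⟨hr ▸ hz, by rw [hr, hr']⟩,
        up_mem_rhombus (v := (a, b)).2 (hzv.trans hr'.symm)⟩, ?_⟩
      rintro r' ⟨⟨hr1, hr2⟩, hr3⟩
      have h1 : (a, b) = r'.up := up_mem_rhombus.1 hr3
      have h2 : r'.down = z := hinj hr1 hz (by rw [← hr2, ← h1, hzv])
      exact Rhombus.ext_down_up (h2.trans hr.symm) (by rw [hr', ← h1, hzv])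
    · have hz := down_mem_region (z := (a, b)).1 hc
      obtain ⟨r, hr, hr'⟩ := hrh _ hz
      refine ⟨r, ⟨⟨hr ▸ hz, by rw [hr, hr']⟩, down_mem_rhombus (z := (a, b)).2 hr.symm⟩, ?_⟩
      rintro r' ⟨⟨hr1, hr2⟩, hr3⟩
      have h1 : (a, b) = r'.down := down_mem_rhombus.1 hr3
      exact Rhombus.ext_down_up (h1.symm.trans hr.symm) (by rw [hr2, hr', ← h1])

/-! ### What a saturated triangle forces -/

/-- In a saturated triangle, each upward cell is matched with a downward cell of the triangle. -/
theorem IsTiling.exists_rhombus {n : ℕ} {S : Finset Tri} (h : IsArrangement n S) {T : Tri}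
    (hT : Saturated n S T) {R : Set Rhombus} (hR : IsTiling n S R) {v : ℕ × ℕ}
    (hv : v ∈ T.ups \ holeUps S) : ∃ r ∈ R, r.up = v ∧ r.down ∈ T.downs := by
  obtain ⟨hTn, hcard⟩ := h.saturated_iff.1 hT
  have hsub : ∀ z ∈ T.downs \ holeDowns S, ∃ r ∈ R, r.down = z := by
    intro z hz
    have hz' : z ∈ (big n).downs \ holeDowns S := by
      refine mem_sdiff.2 ⟨?_, (mem_sdiff.1 hz).2⟩
      have h1 := Tri.mem_downs.1 (mem_sdiff.1 hz).1
      rw [Tri.Inside] at hTn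
      simp only [Tri.mem_downs, big]
      omega
    obtain ⟨r, ⟨hr, hrz⟩, -⟩ := hR.covers _ (down_mem_region.2 hz')
    exact ⟨r, hr, (down_mem_rhombus.1 hrz).symm⟩
  have : Nonempty Rhombus := ⟨⟨0, 0, .bottom⟩⟩
  choose! f hf hfz using hsub
  -- The partners of the free downward cells of `T` lie in `T` and are distinct; as the numbers
  -- agree, they are all the free upward cells.
  obtain ⟨z, hz, hzv⟩ := surj_on_of_inj_on_of_card_le (s := T.downs \ holeDowns S)
    (t := T.ups \ holeUps S) (fun z _ => (f z).up)
    (fun z hz => by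
      refine mem_sdiff.2 ⟨?_, (mem_sdiff.1 (hR.up_mem (hf z hz))).2⟩
      have h1 := (f z).up_mem_nbrs
      rw [hfz z hz] at h1
      exact Tri.nbrs_subset_ups.2 (mem_sdiff.1 hz).1 h1)
    (fun z w hz hw hzw => by
      rw [← hfz z hz, ← hfz w hw, hR.eq_of_up_eq (hf z hz) (hf w hw) hzw])
    hcard.le v hv
  refine ⟨f z, hf z hz, hzv.symm, ?_⟩
  rw [hfz z hz]
  exact (mem_sdiff.1 hz).1

/-- The upward cell at `e` is either in a hole, of which `e` is then a boundary segment, or it has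
its partner inside `T`, hence not across `e`. -/
theorem forced_of_mem_boundary {n : ℕ} {S : Finset Tri} (h : IsArrangement n S) {T : Tri}
    (hT : Saturated n S T) {e : Segment} (he : e ∈ boundary T.cells)
    (heS : ∀ s ∈ S, e ∉ interiorSegments s.cells) : Forced n S e := by
  intro R hR
  rw [Tri.mem_boundary] at he
  by_cases hS : e.pos ∈ holeUps S
  · obtain ⟨s, hs, hes⟩ := mem_biUnion.1 hS
    refine Or.inr ⟨s, hs, Tri.mem_boundary.2 ⟨hes, fun z hz hez => ?_⟩⟩
    exact heS s hs (Tri.mem_interiorSegments.2 ⟨z, hz, hez⟩)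
  · obtain ⟨r, hr, hre, hrT⟩ := hR.exists_rhombus h hT (mem_sdiff.2 ⟨he.1, hS⟩)
    exact Or.inl ⟨r, hr, Rhombus.mem_boundary.2 ⟨Or.inl hre.symm, fun h => he.2 _ hrT h.2⟩⟩

/-- Induction on the placement. The partner of the upward half of `r` is in `T`. Across a side other
than `σ`, it would belong to a rhombus placed before, which is in the tiling and has another upward
half. -/
theorem CornerPlaced.mem_tiling {n : ℕ} {S : Finset Tri} (h : IsArrangement n S) {T : Tri}
    (hT : Saturated n S T) {σ : Side} {r : Rhombus} (hr : CornerPlaced S T σ r)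
    {R : Set Rhombus} (hR : IsTiling n S R) : r ∈ R := by
  induction hr with
  | place r side_eq inside unobstructed corner ih =>
    have hrT : r.up ∈ T.ups := up_mem_cells.1 (inside (up_mem_rhombus.2 rfl))
    have hrS : r.up ∉ holeUps S := fun hmem =>
      Set.disjoint_left.1 unobstructed (up_mem_rhombus.2 rfl) (up_mem_holeCells.2 hmem)
    obtain ⟨r', hr', hup, hdown⟩ := hR.exists_rhombus h hT (mem_sdiff.2 ⟨hrT, hrS⟩)
    have hside : r'.side = σ := by
      by_contra hne
      have h1 := ih ⟨r.up.1, r.up.2, r'.side⟩ (by rw [r.upCell_eq, mem_sides_up]; rfl)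
        (by
          rw [r.diagonal_eq, side_eq]
          exact fun h => hne (congrArg Segment.side h)) r'.down.1 r'.down.2
        (by rw [mem_sides_down]; exact hup.symm) (down_mem_cells.2 hdown)
      exact hne (congrArg Rhombus.side (hR.eq_of_down_eq hr' h1 rfl))
    have hrr' : r' = r := by
      refine Rhombus.ext_down ?_ (hside.trans side_eq.symm)
      rw [Rhombus.up, Rhombus.up, hside, side_eq] at hup
      exact add_right_cancel hup
    exact hrr' ▸ hr'

theorem CornerPlaced.forced {n : ℕ} {S : Finset Tri} (h : IsArrangement n S) {T : Tri}
    (hT : Saturated n S T) {σ : Side} {r : Rhombus} (hr : CornerPlaced S T σ r) {e : Segment}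
    (he : e ∈ boundary r.cells) : Forced n S e :=
  fun _ hR => Or.inl ⟨r, hr.mem_tiling h hT hR, he⟩

/-! ### Parallelograms in the corners of a triangle -/

theorem InSector.trans {d z w : ℕ × ℕ} {σ : Side} (h : InSector d σ z) (h' : InSector z σ w) :
    InSector d σ w := by
  cases σ <;> simp only [InSector] at * <;> omega

/-- The downward cells next to the cell `z`, on its way to the corner. -/
theorem exists_corner_step {T : Tri} {z w : ℕ × ℕ} {σ : Side} (hz : z ∈ T.downs)
    (hw : w ∈ T.downs) (hzw : InSector z σ w) (hne : w ≠ z) :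
    ∃ τ ≠ σ, ∃ z' ∈ T.downs, z + σ.offset = z' + τ.offset ∧ InSector z' σ w := by
  obtain ⟨a, b⟩ := z
  obtain ⟨a', b'⟩ := w
  rw [Tri.mem_downs] at hz hw
  simp only [Ne, Prod.mk.injEq] at hne
  simp only at hz hw
  cases σ <;> simp only [InSector] at hzw
  · by_cases h : a' < a
    · refine ⟨.left, by simp, (a - 1, b + 1), ?_⟩
      simp only [Tri.mem_downs, InSector, Side.offset, Prod.mk_add_mk, Prod.mk.injEq]
      grind
    · refine ⟨.right, by simp, (a, b + 1), ?_⟩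
      simp only [Tri.mem_downs, InSector, Side.offset, Prod.mk_add_mk]
      grind
  · by_cases h : b' < b
    · refine ⟨.bottom, by simp, (a + 1, b - 1), ?_⟩
      simp only [Tri.mem_downs, InSector, Side.offset, Prod.mk_add_mk, Prod.mk.injEq]
      grind
    · refine ⟨.right, by simp, (a + 1, b), ?_⟩
      simp only [Tri.mem_downs, InSector, Side.offset, Prod.mk_add_mk]
      grind
  · by_cases h : a' < a
    · refine ⟨.left, by simp, (a - 1, b), ?_⟩
      simp only [Tri.mem_downs, InSector, Side.offset, Prod.mk_add_mk, Prod.mk.injEq]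
      grind
    · refine ⟨.bottom, by simp, (a, b - 1), ?_⟩
      simp only [Tri.mem_downs, InSector, Side.offset, Prod.mk_add_mk, Prod.mk.injEq]
      grind

/-- The downward cells next to the cell `w` of a sector, on its way to the tip `d`. -/
theorem exists_tip_step {T : Tri} {d w : ℕ × ℕ} {σ : Side} (hd : d ∈ T.downs)
    (hw : w ∈ T.downs) (hdw : InSector d σ w) (hne : w ≠ d) :
    ∃ w' ∈ T.downs, InSector d σ w' ∧ w' + σ.offset ∈ nbrs w ∧ InSector w' σ w ∧ w' ≠ w := by
  obtain ⟨a, b⟩ := d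
  obtain ⟨a', b'⟩ := w
  rw [Tri.mem_downs] at hd hw
  simp only [Ne, Prod.mk.injEq] at hne
  simp only at hd hw
  cases σ <;> simp only [InSector] at hdw
  · by_cases h : a' < a
    · refine ⟨(a' + 1, b' - 1), ?_⟩
      simp only [Tri.mem_downs, InSector, Side.offset, Prod.mk_add_mk, mem_nbrs, Ne,
        Prod.mk.injEq]
      grind
    · refine ⟨(a', b' - 1), ?_⟩
      simp only [Tri.mem_downs, InSector, Side.offset, Prod.mk_add_mk, mem_nbrs, Ne,
        Prod.mk.injEq]
      grind
  · by_cases h : b' < b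
    · refine ⟨(a' - 1, b' + 1), ?_⟩
      simp only [Tri.mem_downs, InSector, Side.offset, Prod.mk_add_mk, mem_nbrs, Ne,
        Prod.mk.injEq]
      grind
    · refine ⟨(a' - 1, b'), ?_⟩
      simp only [Tri.mem_downs, InSector, Side.offset, Prod.mk_add_mk, mem_nbrs, Ne,
        Prod.mk.injEq]
      grind
  · by_cases h : a' < a
    · refine ⟨(a' + 1, b'), ?_⟩
      simp only [Tri.mem_downs, InSector, Side.offset, Prod.mk_add_mk, mem_nbrs, Ne,
        Prod.mk.injEq]
      grind
    · refine ⟨(a', b' + 1), ?_⟩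
      simp only [Tri.mem_downs, InSector, Side.offset, Prod.mk_add_mk, mem_nbrs, Ne,
        Prod.mk.injEq]
      grind

open scoped Classical in
/-- The number of cells of `T` in the sector of `z`. -/
noncomputable def sectorCard (T : Tri) (σ : Side) (z : ℕ × ℕ) : ℕ :=
  (T.downs.filter (InSector z σ)).card

theorem InSector.antisymm {d z : ℕ × ℕ} {σ : Side} (h : InSector d σ z) (h' : InSector z σ d) :
    d = z := by
  rw [Prod.ext_iff]
  cases σ <;> simp only [InSector] at * <;> omega

/-- This supplies the measure for inductions along a sector, both towards the corner and towards the
tip. -/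
theorem sectorCard_lt {T : Tri} {σ : Side} {d z : ℕ × ℕ} (hd : d ∈ T.downs)
    (h : InSector d σ z) (hne : z ≠ d) : sectorCard T σ z < sectorCard T σ d := by
  classical
  refine card_lt_card (ssubset_iff_of_subset (fun w hw => ?_) |>.2 ⟨d, ?_, ?_⟩)
  · rw [mem_filter] at hw ⊢
    exact ⟨hw.1, h.trans hw.2⟩
  · exact mem_filter.2 ⟨hd, inSector_self _ _⟩
  · exact fun hmem => hne (h.antisymm (mem_filter.1 hmem).2).symm

theorem inSector_of_add_offset_eq {z z' : ℕ × ℕ} {σ τ : Side}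
    (h : z + σ.offset = z' + τ.offset) : InSector z σ z' := by
  by_contra hz
  exact not_inUpSector_of_mem_nbrs (add_offset_mem_nbrs z' τ) hz
    (h ▸ inUpSector_add_offset.2 (inSector_self z σ))

/-- Placing `r` requires the rhombi next to it on the way to the corner, hence the whole
parallelogram up to the corner. It suffices to test upward cells, because a hole containing a
downward cell contains its neighbours. This form connects placement with the `cut` pieces and can be
evaluated without recursion. -/
theorem cornerPlaced_iff {S : Finset Tri} {T : Tri} {σ : Side} {r : Rhombus} :
    CornerPlaced S T σ r ↔ r.side = σ ∧ r.down ∈ T.downs ∧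
      ∀ z ∈ T.downs, InSector r.down σ z → z + σ.offset ∉ holeUps S := by
  constructor
  · intro hr
    induction hr with
    | place r side_eq inside unobstructed corner ih =>
      have hrT : r.down ∈ T.downs := down_mem_cells.1 (inside (down_mem_rhombus.2 rfl))
      refine ⟨side_eq, hrT, fun z hz hrz => ?_⟩
      by_cases hne : z = r.down
      · rw [hne, ← side_eq]
        exact fun hmem =>
          Set.disjoint_left.1 unobstructed (up_mem_rhombus.2 rfl) (up_mem_holeCells.2 hmem)
      · obtain ⟨τ, hτ, z', hz', hzz', hz'z⟩ := exists_corner_step hrT hz hrz hne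
        rw [← side_eq] at hzz'
        exact (ih ⟨r.up.1, r.up.2, τ⟩ (by rw [r.upCell_eq, mem_sides_up]; rfl)
          (by
            rw [r.diagonal_eq, side_eq]
            exact fun h => hτ (congrArg Segment.side h)) z'.1 z'.2
          (by rw [mem_sides_down]; exact hzz') (down_mem_cells.2 hz')).2.2 z hz hz'z
  · rintro ⟨rfl, hr, hS⟩
    induction hk : sectorCard T r.side r.down using Nat.strong_induction_on generalizing r with
    | _ k ih =>
      refine .place r rfl ?_ ?_ ?_
      · rintro c (rfl | rfl)
        · rw [r.upCell_eq]
          exact up_mem_cells.2 (Tri.nbrs_subset_ups.2 hr r.up_mem_nbrs)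
        · exact down_mem_cells.2 hr
      · have hup : r.up ∉ holeUps S := hS _ hr (inSector_self _ _)
        rw [Set.disjoint_left]
        rintro c (rfl | rfl) hc
        · rw [r.upCell_eq, up_mem_holeCells] at hc
          exact hup hc
        · rw [r.downCell_eq, down_mem_holeCells] at hc
          exact hup (nbrs_subset_holeUps hc r.up_mem_nbrs)
      · intro e he hne x y hxy hT
        rw [r.upCell_eq, mem_sides_up] at he
        rw [mem_sides_down, he] at hxy
        have hT := down_mem_cells (z := (x, y)).1 hT
        have hsec : InSector r.down r.side (x, y) := inSector_of_add_offset_eq hxy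
        have hne' : (x, y) ≠ r.down := by
          intro h
          rw [h] at hxy
          have h1 := Side.offset_injective (add_left_cancel hxy)
          apply hne
          rw [r.diagonal_eq, h1]
          exact Segment.ext (congrArg Prod.fst he) (congrArg Prod.snd he) rfl
        exact ih _ (hk ▸ sectorCard_lt hr hsec hne') (r := ⟨x, y, r.side⟩) hT
          (fun z hz hz' => hS z hz (hsec.trans hz')) rfl

/-- A sector with as many upward as downward cells outside the holes contains no hole. -/
theorem notMem_holeUps_of_sector {S : Finset Tri} {T : Tri} {σ : Side} {d : ℕ × ℕ}
    (hd : d ∈ T.downs) (hdS : d ∉ holeDowns S)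
    (hpair : ∀ z ∈ T.downs, InSector d σ z → z + σ.offset ∈ holeUps S → z ∈ holeDowns S) :
    ∀ z ∈ T.downs, InSector d σ z → z + σ.offset ∉ holeUps S := by
  -- From a hole cell `z` one walks towards the tip. All neighbours of `z` are hole cells, and one
  -- of them is across `σ` from a sector cell closer to `d`, which by `hpair` is a hole cell too.
  -- The walk would end at `d`, which is free.
  have key : ∀ k, ∀ z ∈ T.downs, InSector d σ z → sectorCard T σ d - sectorCard T σ z = k →
      z ∉ holeDowns S := by
    intro k
    induction k using Nat.strong_induction_on with
    | _ k ih =>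
      intro z hz hdz hk hzS
      have hne : z ≠ d := fun h => hdS (h ▸ hzS)
      obtain ⟨w, hw, hdw, hwz, hsec, hwne⟩ := exists_tip_step hd hz hdz hne
      have h1 := sectorCard_lt hw hsec hwne.symm
      have h2 := sectorCard_lt hd hdz hne
      refine ih _ ?_ w hw hdw rfl (hpair w hw hdw (nbrs_subset_holeUps hzS hwz))
      omega
  exact fun z hz hdz hmem => key _ z hz hdz rfl (hpair z hz hdz hmem)

/-! ### Segments that are not forced -/

/-- The condition on pieces that yields a tiling containing the rhombus with the halves `u`, `d`. -/
theorem card_piece_le {n : ℕ} {S : Finset Tri} (h : IsArrangement n S) (hS : SpreadOut n S)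
    {d : ℕ × ℕ} {τ : Side} (hd : d ∉ holeDowns S) (hu : d + τ.offset ∉ holeUps S)
    (hsat : ∀ T, Saturated n S T → d + τ.offset ∈ T.ups → d ∈ T.downs)
    (hcorner : ∀ T, Saturated n S T → ∀ r, CornerPlaced S T r.side r → r.down = d → r.side = τ)
    {P : Piece} (hP : IsPiece n d P) :
    (P.2 \ holeDowns S).card ≤ (P.1 \ insert (d + τ.offset) (holeUps S)).card := by
  classical
  have hins : ∀ A : Finset (ℕ × ℕ), A \ insert (d + τ.offset) (holeUps S) =
      (A \ holeUps S).erase (d + τ.offset) := fun A => by rw [sdiff_insert]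
  have hcomm : ∀ (A B : Finset (ℕ × ℕ)) (p : ℕ × ℕ → Prop) [DecidablePred p],
      A.filter p \ B = (A \ B).filter p := by
    intro A B p _
    ext v
    simp only [mem_sdiff, mem_filter]
    tauto
  rw [hins]
  rcases hP with ⟨T, hT, hdT⟩ | ⟨T, hT, hdT, σ⟩ | ⟨T, hT, hdT⟩
  · have h1 := h.card_downs_le hS hT
    -- Only the loss of `u` can break the inequality, and only if `T` is saturated; but then `hsat`
    -- puts `d` into `T`.
    by_cases huT : d + τ.offset ∈ T.ups
    · have h2 := card_erase_add_one (mem_sdiff.2 ⟨huT, hu⟩)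
      have h3 : (T.ups \ holeUps S).card ≠ (T.downs \ holeDowns S).card :=
        fun heq => hdT (hsat T (h.saturated_iff.2 ⟨hT, heq⟩) huT)
      simp only
      omega
    · rwa [erase_eq_of_notMem fun hmem => huT (mem_sdiff.1 hmem).1]
  · have h1 := h.card_downs_le hS hT
    simp only
    rw [hcomm, hcomm]
    have h2 := card_filter_add_card_filter_not (s := T.ups \ holeUps S) (InUpSector d σ)
    have h3 := card_filter_add_card_filter_not (s := T.downs \ holeDowns S) (InSector d σ)
    -- The free upward cells of the sector inject into its free downward cells across `σ`, so
    -- cutting off the sector cannot decrease the surplus of free upward cells.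
    have himage : ∀ v ∈ (T.ups \ holeUps S).filter (InUpSector d σ),
        ∃ z ∈ (T.downs \ holeDowns S).filter (InSector d σ), z + σ.offset = v := by
      intro v hv
      rw [mem_filter, mem_sdiff] at hv
      obtain ⟨z, hz, hz', rfl⟩ := exists_add_offset_of_inUpSector hdT hv.1.1 hv.2
      refine ⟨z, mem_filter.2 ⟨mem_sdiff.2 ⟨hz, fun hzS => hv.1.2 ?_⟩, hz'⟩, rfl⟩
      exact nbrs_subset_holeUps hzS (add_offset_mem_nbrs _ _)
    have hsub : (T.ups \ holeUps S).filter (InUpSector d σ) ⊆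
        ((T.downs \ holeDowns S).filter (InSector d σ)).image (· + σ.offset) := fun v hv => by
      obtain ⟨z, hz, hzv⟩ := himage v hv
      exact mem_image.2 ⟨z, hz, hzv⟩
    have hcard := card_image_of_injective ((T.downs \ holeDowns S).filter (InSector d σ))
      (add_left_injective σ.offset)
    have h4 := card_le_card hsub
    by_cases huP : d + τ.offset ∈ (T.ups \ holeUps S).filter (¬ InUpSector d σ ·)
    · have h5 := card_erase_add_one huP
      -- If losing `u` breaks the inequality, all estimates are equalities: `T` is saturated, and
      -- the injection is onto, which leaves no room for holes in the sector. The rhombus at `d` in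
      -- direction `σ` is then placed, so `σ = τ`; but in this case `u` belongs to the removed
      -- sector.
      by_contra hlt
      have heq : (T.ups \ holeUps S).card = (T.downs \ holeDowns S).card := by omega
      have heq' := eq_of_subset_of_card_le hsub (by omega)
      have hclear := notMem_holeUps_of_sector (S := S) (σ := σ) hdT hd (by
        intro z hz hdz hzS
        by_contra hzS'
        have hmem : z + σ.offset ∈ (T.ups \ holeUps S).filter (InUpSector d σ) := by
          rw [heq']
          exact mem_image.2 ⟨z, mem_filter.2 ⟨mem_sdiff.2 ⟨hz, hzS'⟩, hdz⟩, rfl⟩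
        exact (mem_sdiff.1 (mem_filter.1 hmem).1).2 hzS)
      have hσ : σ = τ := hcorner T (h.saturated_iff.2 ⟨hT, heq⟩) ⟨d.1, d.2, σ⟩
        (cornerPlaced_iff.2 ⟨rfl, hdT, hclear⟩) rfl
      rw [hσ] at huP
      exact (mem_filter.1 huP).2 (inUpSector_add_offset.2 (inSector_self _ _))
    · rw [erase_eq_of_notMem huP]
      omega
  · have h1 := h.card_downs_le hS hT
    -- The removal of `d` makes up for the loss of `u`.
    have h2 := card_erase_add_one (mem_sdiff.2 ⟨hdT, hd⟩)
    have h3 := pred_card_le_card_erase (s := T.ups \ holeUps S) (a := d + τ.offset)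
    simp only
    rw [erase_sdiff_comm]
    omega

/-- With the dummy choice `d = u = (n, n)`, outside `Δ`, the only pieces are whole triangles, and
their condition is spread-outness. -/
theorem exists_isTiling {n : ℕ} {S : Finset Tri} (h : IsArrangement n S) (hS : SpreadOut n S) :
    ∃ R, IsTiling n S R := by
  have hn : ∀ T : Tri, T.Inside n → (n, n) ∉ T.ups ∧ (n, n) ∉ T.downs := by
    intro T hT
    simp only [Tri.Inside] at hT
    simp only [Tri.mem_ups, Tri.mem_downs]
    omega
  have hd : ((n, n) : ℕ × ℕ) ∉ holeDowns S := fun hmem => by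
    obtain ⟨s, hs, hmem⟩ := mem_biUnion.1 hmem
    exact (hn s (h.inside s hs)).2 hmem
  obtain ⟨φ, h1, h2, -⟩ := exists_matching (d := (n, n)) (u := (n, n)) h hd
    (fun hmem => by simp [Tri.mem_downs, big] at hmem; omega) (by
      rintro _ (⟨T, hT, hdT⟩ | ⟨T, hT, hdT, σ⟩ | ⟨T, hT, hdT⟩)
      · rw [sdiff_insert, erase_eq_of_notMem fun hmem => (hn T hT).1 (mem_sdiff.1 hmem).1]
        exact h.card_downs_le hS hT
      · exact absurd hdT (hn T hT).2
      · exact absurd hdT (hn T hT).2)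
  exact ⟨_, isTiling_of_matching h h1 h2⟩

theorem Forced.exists_saturated {n : ℕ} {S : Finset Tri} (h : IsArrangement n S)
    (hS : SpreadOut n S) {e : Segment} (he : Forced n S e) :
    (∃ T : Tri, Saturated n S T ∧ e ∈ boundary T.cells) ∨
      ∃ T : Tri, Saturated n S T ∧ ∃ (σ : Side) (r : Rhombus),
        CornerPlaced S T σ r ∧ e ∈ boundary r.cells := by
  obtain ⟨R, hR⟩ := exists_isTiling h hS
  rcases he R hR with ⟨r, hr, her⟩ | ⟨s, hs, hes⟩
  swap
  · exact Or.inl ⟨s, h.saturated_hole hS hs, hes⟩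
  rw [Rhombus.mem_boundary] at her
  by_cases hdown : ∃ z ∈ (big n).downs, e.pos = z + e.side.offset
  swap
  -- With no downward cell of `Δ` on its other side, `e` is on the boundary of `Δ`, which is
  -- saturated.
  · have hup : e.pos ∈ (big n).ups := by
      rcases her.1 with h1 | h1
      · rw [h1]
        exact (mem_sdiff.1 (hR.up_mem hr)).1
      · exact absurd ⟨_, (mem_sdiff.1 (hR.down_mem hr)).1, h1⟩ hdown
    have hn : 0 < n := by
      simp only [Tri.mem_ups, big] at hup
      omega
    exact Or.inl ⟨big n, h.saturated_big hn,
      Tri.mem_boundary.2 ⟨hup, fun z hz hez => hdown ⟨z, hz, hez⟩⟩⟩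
  obtain ⟨d, hdn, hed⟩ := hdown
  have huniq : ∀ z, e.pos = z + e.side.offset → z = d := fun z hz =>
    add_right_cancel (hz.symm.trans hed)
  by_cases hu : e.pos ∈ holeUps S
  · obtain ⟨s, hs, hes⟩ := mem_biUnion.1 hu
    refine Or.inl ⟨s, h.saturated_hole hS hs, Tri.mem_boundary.2 ⟨hes, fun z hz hez => ?_⟩⟩
    have hzS : z ∈ holeDowns S := mem_biUnion.2 ⟨s, hs, hz⟩
    rcases her.1 with h1 | h1
    · exact (mem_sdiff.1 (hR.up_mem hr)).2 (h1 ▸ hu)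
    · have h2 : r.down = z := (huniq _ h1).trans (huniq _ hez).symm
      exact (mem_sdiff.1 (hR.down_mem hr)).2 (h2 ▸ hzS)
  have hd : d ∉ holeDowns S := fun hmem =>
    hu (hed ▸ nbrs_subset_holeUps hmem (add_offset_mem_nbrs _ _))
  by_contra hcon
  push Not at hcon
  obtain ⟨hcon1, hcon2⟩ := hcon
  rw [hed] at hu
  -- If neither alternative holds, some tiling joins `d` to the upward cell across `e`. Then `e` is
  -- a diagonal and not part of this tiling.
  obtain ⟨φ, h1, h2, h3⟩ := exists_matching h hd
    (fun _ => ⟨add_offset_mem_nbrs d e.side, hu⟩) fun P hP => card_piece_le h hS hd hu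
      (fun T hT huT => by
        by_contra hdT
        refine hcon1 T hT (Tri.mem_boundary.2 ⟨hed ▸ huT, fun z hz hez => hdT ?_⟩)
        exact huniq z hez ▸ hz)
      (fun T hT r hr hrd => by
        by_contra hne
        refine hcon2 T hT _ r hr (Rhombus.mem_boundary.2 ⟨Or.inr (hrd ▸ hed), fun h => hne ?_⟩)
        have := h.1.symm.trans hed
        rw [Rhombus.up, hrd] at this
        exact Side.offset_injective (add_left_cancel this)) hP
  have hdD : d ∈ (big n).downs \ holeDowns S := mem_sdiff.2 ⟨hdn, hd⟩
  rcases he _ (isTiling_of_matching h h1 h2) with ⟨r, ⟨hr, hr'⟩, her⟩ | ⟨s, hs, hes⟩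
  · rw [Rhombus.mem_boundary] at her
    rcases her.1 with h4 | h4
    · have h5 : r.down = d := h1 hr hdD (by rw [h3 hdn, ← hed, h4, hr'])
      exact her.2 ⟨h4, by rw [h5, hed]⟩
    · have h5 := huniq _ h4
      exact her.2 ⟨by rw [hr', h5, h3 hdn, hed], h4⟩
  · rw [Tri.mem_boundary] at hes
    exact hu (hed ▸ mem_biUnion.2 ⟨s, hs, hes.1⟩)

/-! ### Programs for arithmetic terms with bounded sums -/

/-- Arithmetic terms over the input arrays. The summation index of `sum t`, which ranges from `0` to
`n`, is the first variable that is not in scope. -/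
inductive Term
  | const (k : ℕ)
  | var (i : ℕ)
  | input (a : Fin 4) (t : Term)
  | add (s t : Term)
  | sub (s t : Term)
  | sum (t : Term)

/-- The value of a term; the variables in scope are those below `l`. -/
def Term.eval (inp : Memory) : Term → ℕ → (ℕ → ℕ) → ℕ
  | .const k, _, _ => k
  | .var i, l, ρ => if i < l then ρ i else 0
  | .input a t, l, ρ => inp a (t.eval inp l ρ)
  | .add s t, l, ρ => s.eval inp l ρ + t.eval inp l ρ
  | .sub s t, l, ρ => s.eval inp l ρ - t.eval inp l ρ
  | .sum t, l, ρ => ∑ i ∈ Finset.range (inp 0 0 + 1), t.eval inp (l + 1) (Function.update ρ l i)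

/-- The expression that reads a variable. -/
def Expr.var (i : ℕ) : Expr := .read 8 (.const i)

/-- The expression that reads a register. -/
def Expr.reg (r : ℕ) : Expr := .read 9 (.const r)

/-- Run a program for all values from `0` to `n` of the variable `l`. -/
def forLoop (l : ℕ) (p : Program) : Program :=
  .seq (.assign 8 (.const l) (.const 0))
    (.loop (.sub (.add (.read 0 (.const 0)) (.const 1)) (.var l))
      (.seq p (.assign 8 (.const l) (.add (.var l) (.const 1)))))

/-- A program that computes a term in the register `r`, using only registers from `r` on. -/
def Term.compile : Term → ℕ → ℕ → Program
  | .const k, _, r => .assign 9 (.const r) (.const k)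
  | .var i, l, r => .assign 9 (.const r) (if i < l then .var i else .const 0)
  | .input a t, l, r => .seq (t.compile l r) (.assign 9 (.const r) (.read a (.reg r)))
  | .add s t, l, r => .seq (s.compile l r) (.seq (t.compile l (r + 1))
      (.assign 9 (.const r) (.add (.reg r) (.reg (r + 1)))))
  | .sub s t, l, r => .seq (s.compile l r) (.seq (t.compile l (r + 1))
      (.assign 9 (.const r) (.sub (.reg r) (.reg (r + 1)))))
  | .sum t, l, r => .seq (.assign 9 (.const r) (.const 0)) (forLoop l
      (.seq (t.compile (l + 1) (r + 1))
        (.assign 9 (.const r) (.add (.reg r) (.reg (r + 1))))))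

/-- A bound for the running time of the program for a term, as a polynomial in `n`. -/
noncomputable def Term.time : Term → Polynomial ℕ
  | .const _ => 3
  | .var _ => 4
  | .input _ t => t.time + 5
  | .add s t => s.time + t.time + 7
  | .sub s t => s.time + t.time + 7
  -- Each round takes 7 steps to accumulate and 14 for the loop; outside the rounds there are 11
  -- steps of the loop and 3 to clear the register.
  | .sum t => (Polynomial.X + 1) * (t.time + 21) + 14

theorem Memory.write_same (m : Memory) (a i v : ℕ) : m.write a i v a i = v := by
  simp [Memory.write]

theorem Memory.write_of_ne_array (m : Memory) {a b : ℕ} (i v : ℕ) (h : b ≠ a) :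
    m.write a i v b = m b := by
  simp [Memory.write, h]

theorem Memory.write_of_ne (m : Memory) (a v : ℕ) {i j : ℕ} (h : j ≠ i) :
    m.write a i v a j = m a j := by
  simp [Memory.write, h]

theorem Memory.write_of_ne' (m : Memory) {a b i j : ℕ} (v : ℕ) (h : b ≠ a ∨ j ≠ i) :
    m.write a i v b j = m b j := by
  rcases eq_or_ne b a with rfl | hb
  · exact m.write_of_ne b v (h.resolve_left (by simp))
  · rw [m.write_of_ne_array i v hb]

/-- The memory `m` holds the input `inp` and the values `ρ` of the variables below `l`. -/
structure Agrees (inp : Memory) (ρ : ℕ → ℕ) (l : ℕ) (m : Memory) : Prop where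
  input : ∀ a < 4, m a = inp a
  var : ∀ i < l, m 8 i = ρ i

theorem Agrees.write {inp m : Memory} {ρ : ℕ → ℕ} {l a i : ℕ} (h : Agrees inp ρ l m) (v : ℕ)
    (ha : 4 ≤ a) (hi : a = 8 → l ≤ i) : Agrees inp ρ l (m.write a i v) where
  input b hb := by rw [m.write_of_ne_array i v (by omega), h.input b hb]
  var j hj := by rw [m.write_of_ne' v (by omega), h.var j hj]

theorem Agrees.update {inp m : Memory} {ρ : ℕ → ℕ} {l i : ℕ} (h : Agrees inp ρ l m)
    (hi : m 8 l = i) : Agrees inp (Function.update ρ l i) (l + 1) m where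
  input := h.input
  var j hj := by
    rcases eq_or_ne j l with rfl | hne
    · simpa using hi
    · rw [Function.update_of_ne hne, h.var j (by omega)]

theorem Agrees.of_update {inp m : Memory} {ρ : ℕ → ℕ} {l i : ℕ}
    (h : Agrees inp (Function.update ρ l i) (l + 1) m) : Agrees inp ρ l m ∧ m 8 l = i := by
  refine ⟨⟨h.input, fun j hj => ?_⟩, ?_⟩
  · rw [h.var j (by omega), Function.update_of_ne (by omega)]
  · rw [h.var l (by omega), Function.update_self]

/-- `I` is a loop invariant that survives changes of the loop variable. A round costs 8 steps for
the test and 6 for the increment beyond its body; 11 accounts for initialisation (3) and the failing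
test (8). -/
theorem run_forLoop {inp : Memory} {ρ : ℕ → ℕ} {l B : ℕ} {p : Program} (I : ℕ → Memory → Prop)
    (hstable : ∀ i m v, I i m → I i (m.write 8 l v))
    (hbody : ∀ i m, i ≤ inp 0 0 → I i m → Agrees inp (Function.update ρ l i) (l + 1) m →
      ∃ t m', Run p m t m' ∧ t ≤ B ∧ I (i + 1) m' ∧
        Agrees inp (Function.update ρ l i) (l + 1) m')
    {m : Memory} (hm : I 0 m) (hA : Agrees inp ρ l m) :
    ∃ t m', Run (forLoop l p) m t m' ∧ t ≤ (inp 0 0 + 1) * (B + 14) + 11 ∧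
      I (inp 0 0 + 1) m' ∧ Agrees inp ρ l m' := by
  set q : Program := .seq p (.assign 8 (.const l) (.add (.var l) (.const 1))) with hq
  set b : Expr := .sub (.add (.read 0 (.const 0)) (.const 1)) (.var l) with hb
  have hbe : ∀ m, Agrees inp ρ l m → b.eval m = inp 0 0 + 1 - m 8 l := by
    intro m hA
    simp [hb, Expr.eval, Expr.var, hA.input 0 (by omega)]
  have key : ∀ k i m, i + k = inp 0 0 + 1 → I i m → Agrees inp ρ l m → m 8 l = i →
      ∃ t m', Run (.loop b q) m t m' ∧ t ≤ k * (B + 14) + 8 ∧ I (inp 0 0 + 1) m' ∧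
        Agrees inp ρ l m' := by
    intro k
    induction k with
    | zero =>
      intro i m hi hI hA hmi
      have h0 : b.eval m = 0 := by
        rw [hbe m hA]
        omega
      refine ⟨_, m, .loop_false h0, by simp [hb, Expr.cost, Expr.var], ?_, hA⟩
      rw [← hi]
      exact hI
    | succ k ih =>
      intro i m hi hI hA hmi
      have h0 : b.eval m ≠ 0 := by
        rw [hbe m hA]
        omega
      obtain ⟨t, m', hrun, ht, hI', hA'⟩ := hbody i m (by omega) hI (hA.update hmi)
      obtain ⟨hA', hmi'⟩ := hA'.of_update
      obtain ⟨t', m'', hrun', ht', hI'', hA''⟩ := ih (i + 1) (m'.write 8 l (i + 1)) (by omega)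
        (hstable _ _ _ hI') (hA'.write _ (by omega) fun _ => le_rfl) (Memory.write_same _ _ _ _)
      have hassign := Run.assign 8 (.const l) (.add (.var l) (.const 1)) m'
      simp only [Expr.eval, Expr.var, hmi'] at hassign
      refine ⟨_, m'', .loop_true h0 (.seq hrun hassign) hrun', ?_, hI'', hA''⟩
      simp only [hb, Expr.cost, Expr.var]
      linarith
  obtain ⟨t, m', hrun, ht, hI, hA'⟩ := key (inp 0 0 + 1) 0 (m.write 8 l 0) (by omega)
    (hstable _ _ _ hm) (hA.write _ (by omega) fun _ => le_rfl) (Memory.write_same _ _ _ _)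
  refine ⟨_, m', .seq (.assign 8 (.const l) (.const 0) m) hrun, ?_, hI, hA'⟩
  simp only [Expr.cost]
  linarith

/-- Nothing has changed except for the registers from `r` on and the variables from `l` on. -/
structure Frame (l r : ℕ) (m m' : Memory) : Prop where
  array : ∀ a < 8, m' a = m a
  var : ∀ i < l, m' 8 i = m 8 i
  reg : ∀ i < r, m' 9 i = m 9 i

theorem Frame.trans {l r : ℕ} {m m' m'' : Memory} (h : Frame l r m m') (h' : Frame l r m' m'') :
    Frame l r m m'' where
  array a ha := (h'.array a ha).trans (h.array a ha)
  var i hi := (h'.var i hi).trans (h.var i hi)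
  reg i hi := (h'.reg i hi).trans (h.reg i hi)

theorem Frame.mono {l r l' r' : ℕ} {m m' : Memory} (h : Frame l' r' m m') (hl : l ≤ l')
    (hr : r ≤ r') : Frame l r m m' where
  array := h.array
  var i hi := h.var i (by omega)
  reg i hi := h.reg i (by omega)

theorem Frame.write_reg {l r i : ℕ} (m : Memory) (v : ℕ) (hi : r ≤ i) :
    Frame l r m (m.write 9 i v) where
  array a ha := m.write_of_ne_array i v (by omega)
  var j hj := m.write_of_ne' v (by omega)
  reg j hj := m.write_of_ne' v (by omega)

theorem Frame.write_var {l r i : ℕ} (m : Memory) (v : ℕ) (hi : l ≤ i) :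
    Frame l r m (m.write 8 i v) where
  array a ha := m.write_of_ne_array i v (by omega)
  var j hj := m.write_of_ne' v (by omega)
  reg j hj := m.write_of_ne' v (by omega)

theorem Agrees.frame {inp m m' : Memory} {ρ : ℕ → ℕ} {l r : ℕ} (h : Agrees inp ρ l m)
    (hf : Frame l r m m') : Agrees inp ρ l m' where
  input a ha := (hf.array a (by omega)).trans (h.input a ha)
  var i hi := (hf.var i hi).trans (h.var i hi)

/-- The registers form a stack: by `Frame`, a partial result in register `r` survives the evaluation
of the next subterm in `r + 1`. Arrays below 8, hence also the output, stay untouched. -/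
theorem Term.run_compile (inp : Memory) (t : Term) : ∀ (l r : ℕ) (ρ : ℕ → ℕ) (m : Memory),
    Agrees inp ρ l m → ∃ k m', Run (t.compile l r) m k m' ∧ k ≤ t.time.eval (inp 0 0) ∧
      m' 9 r = t.eval inp l ρ ∧ Frame l r m m' := by
  induction t with
  | const k =>
    intro l r ρ m _
    refine ⟨_, _, .assign _ _ _ _, ?_, Memory.write_same _ _ _ _, .write_reg _ _ le_rfl⟩
    simp [Expr.cost, Term.time]
  | var i =>
    intro l r ρ m hA
    refine ⟨_, _, .assign _ _ _ _, ?_, (Memory.write_same _ _ _ _).trans ?_,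
      .write_reg _ _ le_rfl⟩
    · split_ifs <;> simp [Expr.cost, Expr.var, Term.time]
    · simp only [Term.eval]
      split_ifs with hi
      · exact hA.var i hi
      · rfl
  | input a t ih =>
    intro l r ρ m hA
    obtain ⟨k, m', hrun, hk, hval, hf⟩ := ih l r ρ m hA
    refine ⟨_, _, .seq hrun (.assign _ _ _ _), ?_, (Memory.write_same _ _ _ _).trans ?_,
      hf.trans (.write_reg _ _ le_rfl)⟩
    · simp [Expr.cost, Expr.reg, Term.time]
      omega
    · simp only [Expr.eval, Expr.reg, Term.eval, hval]
      rw [(hA.frame hf).input a a.2]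
  | add s t ihs iht =>
    intro l r ρ m hA
    obtain ⟨k, m', hrun, hk, hval, hf⟩ := ihs l r ρ m hA
    obtain ⟨k', m'', hrun', hk', hval', hf'⟩ := iht l (r + 1) ρ m' (hA.frame hf)
    refine ⟨_, _, .seq hrun (.seq hrun' (.assign _ _ _ _)), ?_,
      (Memory.write_same _ _ _ _).trans ?_,
      hf.trans ((hf'.mono le_rfl (by omega)).trans (.write_reg _ _ le_rfl))⟩
    · simp [Expr.cost, Expr.reg, Term.time]
      omega
    · simp only [Expr.eval, Expr.reg, Term.eval, hval', hf'.reg r (by omega), hval]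
  | sub s t ihs iht =>
    intro l r ρ m hA
    obtain ⟨k, m', hrun, hk, hval, hf⟩ := ihs l r ρ m hA
    obtain ⟨k', m'', hrun', hk', hval', hf'⟩ := iht l (r + 1) ρ m' (hA.frame hf)
    refine ⟨_, _, .seq hrun (.seq hrun' (.assign _ _ _ _)), ?_,
      (Memory.write_same _ _ _ _).trans ?_,
      hf.trans ((hf'.mono le_rfl (by omega)).trans (.write_reg _ _ le_rfl))⟩
    · simp [Expr.cost, Expr.reg, Term.time]
      omega
    · simp only [Expr.eval, Expr.reg, Term.eval, hval', hf'.reg r (by omega), hval]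
  | sum t ih =>
    intro l r ρ m hA
    have hA₀ := hA.frame (.write_reg (r := r) m 0 le_rfl)
    obtain ⟨k, m', hrun, hk, ⟨hval, hf⟩, -⟩ := run_forLoop (p := .seq (t.compile (l + 1) (r + 1))
        (.assign 9 (.const r) (.add (.reg r) (.reg (r + 1)))))
      (fun i m' => m' 9 r = ∑ j ∈ Finset.range i, t.eval inp (l + 1) (Function.update ρ l j) ∧
        Frame l r m m')
      (B := t.time.eval (inp 0 0) + 7)
      (fun i m' v ⟨h1, h2⟩ => ⟨by rw [m'.write_of_ne' v (by omega), h1],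
        h2.trans (.write_var _ _ le_rfl)⟩)
      (fun i m' hi ⟨h1, h2⟩ hA' => by
        obtain ⟨k, m'', hrun, hk, hval, hf⟩ := ih (l + 1) (r + 1) _ m' hA'
        refine ⟨_, _, .seq hrun (.assign _ _ _ _), ?_,
          ⟨(Memory.write_same _ _ _ _).trans ?_, ?_⟩, ?_⟩
        · simp [Expr.cost, Expr.reg]
          omega
        · simp only [Expr.eval, Expr.reg, hval, hf.reg r (by omega), h1, Finset.sum_range_succ]
        · exact h2.trans ((hf.mono (by omega) (by omega)).trans (.write_reg _ _ le_rfl))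
        · exact (hA'.frame hf).write _ (by omega) (by omega))
      (m := m.write 9 r 0) ⟨Memory.write_same _ _ _ _, .write_reg _ _ le_rfl⟩ hA₀
    refine ⟨_, m', .seq (.assign _ _ _ _) hrun, ?_, hval, hf⟩
    simp [Expr.cost, Term.time]
    linarith

/-! ### Programs that extend the output -/

/-- The program `p` adds the triples in `A ρ` to the output, in at most `B` steps. -/
def Emits (inp : Memory) (l : ℕ) (p : Program) (A : (ℕ → ℕ) → Set (ℕ × ℕ × ℕ)) (B : ℕ) : Prop :=
  ∀ (ρ : ℕ → ℕ) (m : Memory), Agrees inp ρ l m → ∃ k m', Run p m k m' ∧ k ≤ B ∧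
    Agrees inp ρ l m' ∧ {w | w ∈ output m'} = {w | w ∈ output m} ∪ A ρ

theorem output_congr {m m' : Memory} (h : ∀ a, 4 ≤ a → a < 8 → m' a = m a) :
    output m' = output m := by
  simp only [output, h 4 le_rfl (by omega), h 5 (by omega) (by omega), h 6 (by omega) (by omega),
    h 7 (by omega) (by omega)]

theorem Emits.seq {inp : Memory} {l B B' : ℕ} {p q : Program}
    {A A' : (ℕ → ℕ) → Set (ℕ × ℕ × ℕ)} (h : Emits inp l p A B) (h' : Emits inp l q A' B') :
    Emits inp l (.seq p q) (fun ρ => A ρ ∪ A' ρ) (B + B') := by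
  intro ρ m hA
  obtain ⟨k, m', hrun, hk, hA', hout⟩ := h ρ m hA
  obtain ⟨k', m'', hrun', hk', hA'', hout'⟩ := h' ρ m' hA'
  exact ⟨_, m'', .seq hrun hrun', by omega, hA'', by rw [hout', hout, Set.union_assoc]⟩

theorem Emits.forLoop {inp : Memory} {l B : ℕ} {p : Program}
    {A : (ℕ → ℕ) → Set (ℕ × ℕ × ℕ)} (h : Emits inp (l + 1) p A B) :
    Emits inp l (forLoop l p) (fun ρ => ⋃ i ≤ inp 0 0, A (Function.update ρ l i))
      ((inp 0 0 + 1) * (B + 14) + 11) := by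
  intro ρ m hA
  obtain ⟨k, m', hrun, hk, hI, hA'⟩ := run_forLoop (inp := inp) (ρ := ρ) (l := l) (p := p) (B := B)
    (fun i m' => {w | w ∈ output m'} =
      {w | w ∈ output m} ∪ ⋃ j < i, A (Function.update ρ l j))
    (fun i m' v h1 => by
      rw [← h1, output_congr fun a ha ha' => m'.write_of_ne_array l v (by omega)])
    (fun i m' hi h1 hA' => by
      obtain ⟨k, m'', hrun, hk, hA'', hout⟩ := h _ m' hA'
      refine ⟨k, m'', hrun, hk, ?_, hA''⟩
      rw [hout, h1, Set.union_assoc, Set.biUnion_lt_succ])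
    (m := m) (by simp) hA
  refine ⟨k, m', hrun, hk, hA', ?_⟩
  simpa only [Nat.lt_succ_iff] using hI

/-- Add the triple consisting of the first two variables and the constant `c` to the output. -/
def append (c : ℕ) : Program :=
  .seq (.assign 5 (.read 4 (.const 0)) (.var 0)) (.seq (.assign 6 (.read 4 (.const 0)) (.var 1))
    (.seq (.assign 7 (.read 4 (.const 0)) (.const c))
      (.assign 4 (.const 0) (.add (.read 4 (.const 0)) (.const 1)))))

theorem emits_append (inp : Memory) (c : ℕ) :
    Emits inp 2 (append c) (fun ρ => {(ρ 0, ρ 1, c)}) 20 := by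
  intro ρ m hA
  set k := m 4 0 with hk
  have h0 := hA.var 0 (by omega)
  have h1 := hA.var 1 (by omega)
  set m₁ := m.write 5 k (ρ 0) with hm₁
  set m₂ := m₁.write 6 k (ρ 1) with hm₂
  set m₃ := m₂.write 7 k c with hm₃
  set m₄ := m₃.write 4 0 (k + 1) with hm₄
  have r₁ := Run.assign 5 (.read 4 (.const 0)) (.var 0) m
  have r₂ := Run.assign 6 (.read 4 (.const 0)) (.var 1) m₁
  have r₃ := Run.assign 7 (.read 4 (.const 0)) (.const c) m₂
  have r₄ := Run.assign 4 (.const 0) (.add (.read 4 (.const 0)) (.const 1)) m₃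
  simp only [Expr.eval, Expr.var, h0, ← hk, ← hm₁] at r₁
  have e₁ : m₁ 4 0 = k := m.write_of_ne' _ (by omega)
  have e₁' : m₁ 8 1 = ρ 1 := (m.write_of_ne' _ (by omega)).trans h1
  simp only [Expr.eval, Expr.var, e₁, e₁', ← hm₂] at r₂
  have e₂ : m₂ 4 0 = k := (m₁.write_of_ne' _ (by omega)).trans e₁
  simp only [Expr.eval, e₂, ← hm₃] at r₃
  have e₃ : m₃ 4 0 = k := (m₂.write_of_ne' _ (by omega)).trans e₂
  simp only [Expr.eval, e₃, ← hm₄] at r₄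
  refine ⟨_, m₄, .seq r₁ (.seq r₂ (.seq r₃ r₄)), by simp [Expr.cost], ?_, ?_⟩
  · exact (((hA.write _ (by omega) (by omega)).write _ (by omega) (by omega)).write _ (by omega)
      (by omega)).write _ (by omega) (by omega)
  · have hout : output m₄ = output m ++ [(ρ 0, ρ 1, c)] := by
      have f4 : m₄ 4 0 = k + 1 := Memory.write_same _ _ _ _
      have f5 : m₄ 5 = Function.update (m 5) k (ρ 0) := by
        simp [hm₄, hm₃, hm₂, hm₁, Memory.write]
      have f6 : m₄ 6 = Function.update (m 6) k (ρ 1) := by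
        simp [hm₄, hm₃, hm₂, hm₁, Memory.write]
      have f7 : m₄ 7 = Function.update (m 7) k c := by
        simp [hm₄, hm₃, hm₂, hm₁, Memory.write]
      simp only [output, f4, f5, f6, f7, List.range_succ, List.map_append, List.map_cons,
        List.map_nil, Function.update_self, ← hk]
      congr 1
      refine List.map_congr_left fun i hi => ?_
      rw [List.mem_range] at hi
      simp only [Function.update_of_ne hi.ne]
    ext w
    simp [hout, or_comm]

/-- Add the triple consisting of the first two variables and the constant `c` to the output, if the
value of a term is not zero. -/
def emitIf (t : Term) (c : ℕ) : Program :=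
  .seq (t.compile 2 0) (.cond (.reg 0) (append c) .skip)

theorem emits_emitIf (inp : Memory) (t : Term) (c : ℕ) :
    Emits inp 2 (emitIf t c) (fun ρ => {w | t.eval inp 2 ρ ≠ 0 ∧ w = (ρ 0, ρ 1, c)})
      (t.time.eval (inp 0 0) + 23) := by
  intro ρ m hA
  obtain ⟨k, m', hrun, hk, hval, hf⟩ := t.run_compile inp 2 0 ρ m hA
  have hout : output m' = output m := output_congr fun a _ ha => hf.array a ha
  by_cases h0 : t.eval inp 2 ρ = 0
  · refine ⟨_, m', .seq hrun (.cond_false (hval.trans h0) (.skip m')), ?_, hA.frame hf, ?_⟩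
    · simp [Expr.cost, Expr.reg]
      omega
    · simp [hout, h0]
  · obtain ⟨k', m'', hrun', hk', hA', hout'⟩ := emits_append inp c ρ m' (hA.frame hf)
    refine ⟨_, m'', .seq hrun (.cond_true (hval.trans_ne h0) hrun'), ?_, hA', ?_⟩
    · simp [Expr.cost, Expr.reg]
      omega
    · rw [hout', hout]
      simp [h0]

/-! ### A bounded formula for forced segments -/

/-- A term, viewed as a truth value. -/
def Term.Holds (inp : Memory) (t : Term) (l : ℕ) (ρ : ℕ → ℕ) : Prop := t.eval inp l ρ ≠ 0

namespace Term

/-- Truth is being nonzero, so truncated subtraction negates and addition is disjunction. In the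
absence of multiplication, conjunction goes through De Morgan's law. -/
def not (t : Term) : Term := .sub (.const 1) t

def and (s t : Term) : Term := (s.not.add t.not).not

def or (s t : Term) : Term := s.add t

def le (s t : Term) : Term := .sub (.add t (.const 1)) s

def eq (s t : Term) : Term := (s.le t).and (t.le s)

def ex (t : Term) : Term := .sum t

def all (t : Term) : Term := t.not.ex.not

def min (s t : Term) : Term := .sub s (.sub s t)

def max (s t : Term) : Term := .add s (.sub t s)

variable {inp : Memory} {l : ℕ} {ρ : ℕ → ℕ} {s t : Term}

theorem holds_not : (not t).Holds inp l ρ ↔ ¬ t.Holds inp l ρ := by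
  simp only [Holds, not, eval]
  omega

theorem holds_and : (and s t).Holds inp l ρ ↔ s.Holds inp l ρ ∧ t.Holds inp l ρ := by
  simp only [Holds, not, and, eval]
  omega

theorem holds_or : (or s t).Holds inp l ρ ↔ s.Holds inp l ρ ∨ t.Holds inp l ρ := by
  simp only [Holds, or, eval]
  omega

theorem holds_le : (le s t).Holds inp l ρ ↔ s.eval inp l ρ ≤ t.eval inp l ρ := by
  simp only [Holds, le, eval]
  omega

theorem holds_eq : (eq s t).Holds inp l ρ ↔ s.eval inp l ρ = t.eval inp l ρ := by
  rw [eq, holds_and, holds_le, holds_le]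
  omega

theorem holds_ex : (ex t).Holds inp l ρ ↔
    ∃ i ≤ inp 0 0, t.Holds inp (l + 1) (Function.update ρ l i) := by
  simp only [Holds, ex, eval, ne_eq, sum_eq_zero_iff, mem_range, Nat.lt_succ_iff]
  push Not
  rfl

theorem holds_all : (all t).Holds inp l ρ ↔
    ∀ i ≤ inp 0 0, t.Holds inp (l + 1) (Function.update ρ l i) := by
  simp only [all, holds_not, holds_ex]
  push Not
  rfl

theorem eval_min : (min s t).eval inp l ρ = Min.min (s.eval inp l ρ) (t.eval inp l ρ) := by
  simp only [min, eval]
  omega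

theorem eval_max : (max s t).eval inp l ρ = Max.max (s.eval inp l ρ) (t.eval inp l ρ) := by
  simp only [max, eval]
  omega

end Term

/-- A triangle whose coordinates are given by terms. -/
structure TriTerm where
  x : Term
  y : Term
  size : Term

namespace TriTerm

/-- The triangle described by a triple of terms. -/
def eval (inp : Memory) (T : TriTerm) (l : ℕ) (ρ : ℕ → ℕ) : Tri :=
  ⟨T.x.eval inp l ρ, T.y.eval inp l ρ, T.size.eval inp l ρ⟩

/-- The hole with a given index. -/
def hole (i : Term) : TriTerm := ⟨.input 1 i, .input 2 i, .input 3 i⟩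

/-- The sum of the coordinates of a point on the right side of the triangle. -/
def top (T : TriTerm) : Term := (T.x.add T.y).add T.size

/-- The cell `up a b` is contained in `T`. -/
def hasUp (T : TriTerm) (a b : Term) : Term :=
  (T.x.le a).and ((T.y.le b).and (((a.add b).add (.const 1)).le T.top))

/-- The side `s` of `up a b` is in the interior of `T`. -/
def hasInner (T : TriTerm) (a b : Term) : Side → Term
  | .bottom => (T.x.le a).and (((T.y.add (.const 1)).le b).and
      (((a.add b).add (.const 1)).le T.top))
  | .left => ((T.x.add (.const 1)).le a).and ((T.y.le b).and
      (((a.add b).add (.const 1)).le T.top))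
  | .right => (T.x.le a).and ((T.y.le b).and (((a.add b).add (.const 2)).le T.top))

/-- The size of the intersection of two triangles. -/
def interSize (s T : TriTerm) : Term :=
  (s.top.min T.top).sub ((s.x.max T.x).add (s.y.max T.y))

variable {inp : Memory} {l : ℕ} {ρ : ℕ → ℕ} {s T : TriTerm} {a b : Term}

theorem holds_hasUp : (T.hasUp a b).Holds inp l ρ ↔
    (a.eval inp l ρ, b.eval inp l ρ) ∈ (T.eval inp l ρ).ups := by
  simp only [hasUp, Term.holds_and, Term.holds_le, Term.eval, top, Tri.mem_ups, eval]
  omega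

theorem holds_hasInner {τ : Side} : (T.hasInner a b τ).Holds inp l ρ ↔
    ∃ z ∈ (T.eval inp l ρ).downs, (a.eval inp l ρ, b.eval inp l ρ) = z + τ.offset := by
  cases τ <;>
    simp only [hasInner, Term.holds_and, Term.holds_le, Term.eval, top, Tri.mem_downs, eval,
      Side.offset, Prod.exists, Prod.mk_add_mk, Prod.mk.injEq]
  · constructor
    · intro h
      exact ⟨a.eval inp l ρ, b.eval inp l ρ - 1, by omega⟩
    · rintro ⟨a', b', h⟩
      omega
  · constructor
    · intro h
      exact ⟨a.eval inp l ρ - 1, b.eval inp l ρ, by omega⟩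
    · rintro ⟨a', b', h⟩
      omega
  · constructor
    · intro h
      exact ⟨a.eval inp l ρ, b.eval inp l ρ, by omega⟩
    · rintro ⟨a', b', h⟩
      omega

theorem eval_interSize : (interSize s T).eval inp l ρ =
    ((s.eval inp l ρ).inter (T.eval inp l ρ)).size := by
  simp only [interSize, Term.eval, Term.eval_min, Term.eval_max, top, Tri.inter, eval]

end TriTerm

/-- The cell `(a, b)` is in the sector of the cell `(x, y)`. -/
def sectorTerm (x y a b : Term) : Side → Term
  | .bottom => (a.le x).and ((x.add y).le (a.add b))
  | .right => (a.le x).and (b.le y)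
  | .left => (b.le y).and ((x.add y).le (a.add b))

theorem holds_sectorTerm {inp : Memory} {l : ℕ} {ρ : ℕ → ℕ} {x y a b : Term} {σ : Side} :
    (sectorTerm x y a b σ).Holds inp l ρ ↔
      InSector (x.eval inp l ρ, y.eval inp l ρ) σ (a.eval inp l ρ, b.eval inp l ρ) := by
  cases σ <;> simp only [sectorTerm, Term.holds_and, Term.holds_le, Term.eval, InSector]

/-- The cell with the coordinates `(a, b) + σ.offset` is `(x, y)`. -/
def offsetTerm (x y a b : Term) (σ : Side) : Term :=
  (x.eq (a.add (.const σ.offset.1))).and (y.eq (b.add (.const σ.offset.2)))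

theorem holds_offsetTerm {inp : Memory} {l : ℕ} {ρ : ℕ → ℕ} {x y a b : Term} {σ : Side} :
    (offsetTerm x y a b σ).Holds inp l ρ ↔ (x.eval inp l ρ, y.eval inp l ρ) =
      (a.eval inp l ρ, b.eval inp l ρ) + σ.offset := by
  simp only [offsetTerm, Term.holds_and, Term.holds_eq, Term.eval, Prod.ext_iff, Prod.fst_add,
    Prod.snd_add]

/-- The triangle given by the variables 2, 3, 4. -/
def varTri : TriTerm := ⟨.var 2, .var 3, .var 4⟩

/-- The triangle given by the variables 2, 3, 4 is saturated. -/
def saturatedTerm : Term :=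
  ((Term.const 1).le (.var 4)).and ((varTri.top.le (.input 0 (.const 0))).and
    ((Term.sum ((TriTerm.hole (.var 5)).interSize varTri)).eq (.var 4)))

/-- The rhombus at the variables 5, 6 is placed in the corner opposite to `σ` of the triangle given
by the variables 2, 3, 4. -/
def placedTerm (σ : Side) : Term :=
  -- Since `down a b` is across the right side of `up a b`, `hasInner` with `.right` tests whether
  -- `down a b` is in the triangle.
  (varTri.hasInner (.var 5) (.var 6) .right).and (Term.all (Term.all
    (((varTri.hasInner (.var 7) (.var 8) .right).and
      (sectorTerm (.var 5) (.var 6) (.var 7) (.var 8) σ)).not.or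
      (Term.all ((TriTerm.hole (.var 9)).hasUp ((Term.var 7).add (.const σ.offset.1))
        ((Term.var 8).add (.const σ.offset.2))).not))))

/-- The side `τ` of the upward cell at the variables 0, 1 is on the boundary of the rhombus
at the variables 5, 6 in the direction `σ`. -/
def rhombusTerm (σ τ : Side) : Term :=
  ((offsetTerm (.var 0) (.var 1) (.var 5) (.var 6) σ).or
    (offsetTerm (.var 0) (.var 1) (.var 5) (.var 6) τ)).and
  ((offsetTerm (.var 0) (.var 1) (.var 5) (.var 6) σ).and
    (offsetTerm (.var 0) (.var 1) (.var 5) (.var 6) τ)).not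

/-- The side `τ` of the upward cell at the variables 0, 1 is a side of a rhombus placed in the
corner opposite to `σ` of the triangle given by the variables 2, 3, 4. -/
def cornerTerm (τ σ : Side) : Term := Term.ex (Term.ex ((placedTerm σ).and (rhombusTerm σ τ)))

/-- The side `τ` of the upward cell at the variables 0, 1 is on the boundary of the triangle given
by the variables 2, 3, 4. -/
def boundaryTerm (τ : Side) : Term :=
  (varTri.hasUp (.var 0) (.var 1)).and (varTri.hasInner (.var 0) (.var 1) τ).not

/-- The side `τ` of the upward cell at the variables 0, 1 is forced. -/
def forcedTerm (τ : Side) : Term :=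
  ((Term.ex (Term.ex (Term.ex (saturatedTerm.and (boundaryTerm τ))))).and
    (Term.ex ((TriTerm.hole (.var 2)).hasInner (.var 0) (.var 1) τ)).not).or
  (Term.ex (Term.ex (Term.ex (saturatedTerm.and
    ((cornerTerm τ .bottom).or ((cornerTerm τ .left).or (cornerTerm τ .right)))))))

/-! ### Holes in the input -/

/-- The hole with the index `i`; it is `⟨0, 0, 0⟩` if `i` is too large. -/
def Memory.hole (inp : Memory) (i : ℕ) : Tri := ⟨inp 1 i, inp 2 i, inp 3 i⟩

/-- The input arrays describe the holes of `S`. -/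
structure Encodes (n : ℕ) (S : Finset Tri) (inp : Memory) : Prop where
  size : inp 0 0 = n
  -- There are at most `n` holes, as their positive sizes sum to `n`. Indices beyond the list read
  -- as `⟨0, 0, 0⟩` and must not contribute.
  sum : ∀ g : Tri → ℕ, g ⟨0, 0, 0⟩ = 0 → ∑ i ∈ range (n + 1), g (inp.hole i) = ∑ s ∈ S, g s

theorem Encodes.exists_iff {n : ℕ} {S : Finset Tri} {inp : Memory} (h : Encodes n S inp)
    {Q : Tri → Prop} (hQ : ¬ Q ⟨0, 0, 0⟩) : (∃ i ≤ n, Q (inp.hole i)) ↔ ∃ s ∈ S, Q s := by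
  classical
  have h1 := h.sum (fun s => if Q s then 1 else 0) (if_neg hQ)
  have h2 : (∃ i ≤ n, Q (inp.hole i)) ↔
      ∑ i ∈ range (n + 1), (if Q (inp.hole i) then 1 else 0) ≠ 0 := by
    simp
  rw [h2, h1]
  simp

theorem encodes_inputMemory {n : ℕ} {S : Finset Tri} {holes : List Tri} (h : IsArrangement n S)
    (hnodup : holes.Nodup) (hmem : ∀ s, s ∈ holes ↔ s ∈ S) :
    Encodes n S (inputMemory n holes) := by
  classical
  have hhole : ∀ i, (inputMemory n holes).hole i = holes.getD i ⟨0, 0, 0⟩ := by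
    intro i
    have h1 : inputMemory n holes 1 i = (holes.map Tri.x).getD i 0 := rfl
    have h2 : inputMemory n holes 2 i = (holes.map Tri.y).getD i 0 := rfl
    have h3 : inputMemory n holes 3 i = (holes.map Tri.size).getD i 0 := rfl
    rw [Memory.hole, h1, h2, h3]
    by_cases hi : i < holes.length
    · simp [hi]
    · simp [not_lt.1 hi]
  have hS : holes.toFinset = S := by
    ext s
    rw [List.mem_toFinset, hmem]
  have hlen : holes.length ≤ n := by
    rw [← List.toFinset_card_of_nodup hnodup, hS, ← h.sum_size, card_eq_sum_ones]
    exact sum_le_sum fun s hs => (h.inside s hs).1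
  refine ⟨rfl, fun g hg => ?_⟩
  have h1 : range holes.length ⊆ range (n + 1) := range_subset_range.2 (by omega)
  rw [← sum_subset h1, ← hS, List.sum_toFinset g hnodup]
  · rw [← Fin.sum_univ_eq_sum_range (fun i => g ((inputMemory n holes).hole i)),
      ← Fin.sum_univ_fun_getElem]
    refine sum_congr rfl fun i _ => ?_
    rw [hhole, List.getD_eq_getElem _ _ i.2]
  · intro i _ hi
    rw [mem_range] at hi
    rw [hhole, List.getD_eq_default _ _ (by omega), hg]

/-! ### The meaning of the formula -/

theorem TriTerm.eval_hole {inp : Memory} {l : ℕ} {ρ : ℕ → ℕ} {i : Term} :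
    (TriTerm.hole i).eval inp l ρ = inp.hole (i.eval inp l ρ) := rfl

theorem Tri.ups_zero (a b : ℕ) : (⟨a, b, 0⟩ : Tri).ups = ∅ := by
  ext v
  simp only [Tri.mem_ups, notMem_empty, iff_false]
  omega

theorem Tri.downs_zero (a b : ℕ) : (⟨a, b, 0⟩ : Tri).downs = ∅ := by
  ext v
  simp only [Tri.mem_downs, notMem_empty, iff_false]
  omega

variable {n : ℕ} {S : Finset Tri} {inp : Memory} {ρ : ℕ → ℕ}

theorem eval_var {i l : ℕ} (hi : i < l) : (Term.var i).eval inp l ρ = ρ i := by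
  rw [Term.eval, if_pos hi]

theorem eval_varTri {l : ℕ} (hl : 4 < l) : varTri.eval inp l ρ = ⟨ρ 2, ρ 3, ρ 4⟩ := by
  simp only [TriTerm.eval, varTri, eval_var (show 2 < l by omega), eval_var (show 3 < l by omega),
    eval_var hl]

theorem holds_saturatedTerm (h : Encodes n S inp) :
    saturatedTerm.Holds inp 5 ρ ↔ Saturated n S ⟨ρ 2, ρ 3, ρ 4⟩ := by
  have hsum : (Term.sum ((TriTerm.hole (.var 5)).interSize varTri)).eval inp 5 ρ =
      ∑ s ∈ S, (s.inter ⟨ρ 2, ρ 3, ρ 4⟩).size := by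
    rw [Term.eval, h.size, ← h.sum fun s => (s.inter ⟨ρ 2, ρ 3, ρ 4⟩).size]
    · refine sum_congr rfl fun i _ => ?_
      rw [TriTerm.eval_interSize, TriTerm.eval_hole, eval_varTri (by omega), eval_var (by omega)]
      simp
    · simp [Tri.inter]
  simp only [saturatedTerm, Term.holds_and, Term.holds_le, Term.holds_eq]
  rw [hsum, eval_var (by omega)]
  simp only [TriTerm.top, varTri, Term.eval, Saturated, Tri.Inside, Fin.val_zero, h.size, and_assoc,
    Nat.reduceLT, if_true]
  rfl

theorem holds_placedTerm (h : Encodes n S inp) (σ : Side)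
    (hT : (⟨ρ 2, ρ 3, ρ 4⟩ : Tri).Inside n) :
    (placedTerm σ).Holds inp 7 ρ ↔ CornerPlaced S ⟨ρ 2, ρ 3, ρ 4⟩ σ ⟨ρ 5, ρ 6, σ⟩ := by
  have hright : ∀ (T : Tri) (v : ℕ × ℕ), (∃ z ∈ T.downs, v = z + Side.right.offset) ↔ v ∈ T.downs := by
    intro T v
    constructor
    · rintro ⟨z, hz, rfl⟩
      exact hz
    · exact fun hv => ⟨v, hv, rfl⟩
  -- Inside `Δ` all coordinates are at most `n`, so the bounded quantifiers miss no cell.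
  have hle : ∀ z ∈ (⟨ρ 2, ρ 3, ρ 4⟩ : Tri).downs, z.1 ≤ n ∧ z.2 ≤ n := by
    intro z hz
    rw [Tri.mem_downs] at hz
    simp only [Tri.Inside] at hT hz
    omega
  have key : (placedTerm σ).Holds inp 7 ρ ↔ (ρ 5, ρ 6) ∈ (⟨ρ 2, ρ 3, ρ 4⟩ : Tri).downs ∧
      ∀ a ≤ n, ∀ b ≤ n,
        ¬ ((a, b) ∈ (⟨ρ 2, ρ 3, ρ 4⟩ : Tri).downs ∧ InSector (ρ 5, ρ 6) σ (a, b)) ∨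
          ∀ i ≤ n, (a, b) + σ.offset ∉ (inp.hole i).ups := by
    simp only [placedTerm, Term.holds_and, Term.holds_all, Term.holds_or, Term.holds_not,
      TriTerm.holds_hasInner, hright, holds_sectorTerm, TriTerm.holds_hasUp, TriTerm.eval_hole,
      h.size]
    simp [eval_varTri, Term.eval, Prod.add_def]
  rw [cornerPlaced_iff, key, and_iff_right rfl]
  have hhole : ∀ v : ℕ × ℕ, (∀ i ≤ n, v ∉ (inp.hole i).ups) ↔ v ∉ holeUps S := by
    intro v
    have h1 := h.exists_iff (Q := fun s => v ∈ s.ups) (by simp [Tri.ups_zero])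
    rw [holeUps, mem_biUnion, ← h1]
    push Not
    rfl
  refine and_congr_right fun _ => ⟨fun hall z hz hzσ => ?_, fun hall a _ b _ => ?_⟩
  · rcases hall z.1 (hle z hz).1 z.2 (hle z hz).2 with h1 | h1
    · exact absurd ⟨hz, hzσ⟩ h1
    · exact (hhole _).1 h1
  · by_cases h1 : (a, b) ∈ (⟨ρ 2, ρ 3, ρ 4⟩ : Tri).downs ∧ InSector (ρ 5, ρ 6) σ (a, b)
    · exact Or.inr ((hhole _).2 (hall (a, b) h1.1 h1.2))
    · exact Or.inl h1

theorem holds_rhombusTerm (σ τ : Side) : (rhombusTerm σ τ).Holds inp 7 ρ ↔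
    (⟨ρ 0, ρ 1, τ⟩ : Segment) ∈ boundary (⟨ρ 5, ρ 6, σ⟩ : Rhombus).cells := by
  rw [Rhombus.mem_boundary]
  simp only [rhombusTerm, Term.holds_and, Term.holds_or, Term.holds_not, holds_offsetTerm]
  simp only [Term.eval, Nat.reduceLT, Nat.ofNat_pos, Nat.one_lt_ofNat, if_true]
  rfl

theorem holds_boundaryTerm (τ : Side) : (boundaryTerm τ).Holds inp 5 ρ ↔
    (⟨ρ 0, ρ 1, τ⟩ : Segment) ∈ boundary (⟨ρ 2, ρ 3, ρ 4⟩ : Tri).cells := by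
  rw [Tri.mem_boundary]
  simp only [boundaryTerm, Term.holds_and, Term.holds_not, TriTerm.holds_hasUp,
    TriTerm.holds_hasInner]
  simp only [eval_varTri (show 4 < 5 by omega), Term.eval, Nat.ofNat_pos, Nat.one_lt_ofNat, if_true]
  push Not
  rfl

theorem holds_cornerTerm (h : Encodes n S inp) (σ τ : Side)
    (hT : (⟨ρ 2, ρ 3, ρ 4⟩ : Tri).Inside n) :
    (cornerTerm τ σ).Holds inp 5 ρ ↔ ∃ r : Rhombus, CornerPlaced S ⟨ρ 2, ρ 3, ρ 4⟩ σ r ∧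
      (⟨ρ 0, ρ 1, τ⟩ : Segment) ∈ boundary r.cells := by
  simp only [cornerTerm, Term.holds_ex, h.size, Term.holds_and, Nat.reduceAdd, holds_rhombusTerm]
  constructor
  · rintro ⟨x, hx, y, hy, h1, h2⟩
    rw [holds_placedTerm h] at h1
    · simp at h1 h2
      exact ⟨_, h1, h2⟩
    · simpa using hT
  · rintro ⟨r, h1, h2⟩
    obtain ⟨hside, hr, -⟩ := cornerPlaced_iff.1 h1
    rw [Tri.mem_downs] at hr
    simp only [Tri.Inside, Rhombus.down] at hT hr
    refine ⟨r.x, by omega, r.y, by omega, ?_, ?_⟩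
    · rw [holds_placedTerm h]
      · subst hside
        simpa using h1
      · simpa [Tri.Inside] using hT
    · subst hside
      simpa using h2

/-! ### Exact characterisation of forced segments, and its formula -/

theorem Forced.pos_mem (h : IsArrangement n S) (hS : SpreadOut n S) {e : Segment}
    (he : Forced n S e) : e.pos ∈ (big n).ups := by
  obtain ⟨R, hR⟩ := exists_isTiling h hS
  rcases he R hR with ⟨r, hr, her⟩ | ⟨s, hs, hes⟩
  · rcases (Rhombus.mem_boundary.1 her).1 with h1 | h1
    · rw [h1]
      exact (mem_sdiff.1 (hR.up_mem hr)).1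
    · rw [h1]
      exact Tri.nbrs_subset_ups.2 (mem_sdiff.1 (hR.down_mem hr)).1 (add_offset_mem_nbrs _ _)
  · have h1 := Tri.mem_ups.1 (Tri.mem_boundary.1 hes).1
    have h2 := (h.inside s hs).2
    simp only [Tri.mem_ups, big]
    omega

/-- The existence of a tiling is essential here: without one, every segment would be forced
vacuously. -/
theorem Forced.notMem_interiorSegments (h : IsArrangement n S) (hS : SpreadOut n S) {e : Segment}
    (he : Forced n S e) {s : Tri} (hs : s ∈ S) : e ∉ interiorSegments s.cells := by
  intro hes
  obtain ⟨z, hz, hez⟩ := Tri.mem_interiorSegments.1 hes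
  have hup : e.pos ∈ s.ups := hez ▸ Tri.nbrs_subset_ups.2 hz (add_offset_mem_nbrs _ _)
  obtain ⟨R, hR⟩ := exists_isTiling h hS
  rcases he R hR with ⟨r, hr, her⟩ | ⟨t, ht, het⟩
  · rcases (Rhombus.mem_boundary.1 her).1 with h1 | h1
    · exact (mem_sdiff.1 (hR.up_mem hr)).2 (h1 ▸ mem_biUnion.2 ⟨s, hs, hup⟩)
    · have h2 : r.down = z := add_right_cancel (h1.symm.trans hez)
      exact (mem_sdiff.1 (hR.down_mem hr)).2 (h2 ▸ mem_biUnion.2 ⟨s, hs, hz⟩)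
  · rw [Tri.mem_boundary] at het
    by_cases hst : s = t
    · subst hst
      exact het.2 z hz hez
    · exact Finset.disjoint_left.1 (h.disjoint_ups hs ht hst) hup het.1

theorem forced_iff (h : IsArrangement n S) (hS : SpreadOut n S) {e : Segment} :
    Forced n S e ↔ ((∃ T : Tri, Saturated n S T ∧ e ∈ boundary T.cells) ∧
        ¬ ∃ s ∈ S, e ∈ interiorSegments s.cells) ∨
      ∃ T : Tri, Saturated n S T ∧ ∃ (σ : Side) (r : Rhombus),
        CornerPlaced S T σ r ∧ e ∈ boundary r.cells := by
  constructor
  · intro he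
    refine (he.exists_saturated h hS).imp_left fun h1 => ⟨h1, ?_⟩
    rintro ⟨s, hs, hes⟩
    exact he.notMem_interiorSegments h hS hs hes
  · rintro (⟨⟨T, hT, he⟩, hint⟩ | ⟨T, hT, σ, r, hr, he⟩)
    · exact forced_of_mem_boundary h hT he fun s hs hes => hint ⟨s, hs, hes⟩
    · exact hr.forced h hT he

/-- The three quantifiers bind the variables 2, 3, 4. Bounding them by `n` loses nothing, because
saturated triangles lie in `Δ`. -/
theorem holds_ex_tri (h : Encodes n S inp) {t : Term} {Q : Tri → Prop}
    (hQ : ∀ ρ' : ℕ → ℕ, ρ' 0 = ρ 0 → ρ' 1 = ρ 1 → (t.Holds inp 5 ρ' ↔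
      Saturated n S ⟨ρ' 2, ρ' 3, ρ' 4⟩ ∧ Q ⟨ρ' 2, ρ' 3, ρ' 4⟩)) :
    (Term.ex (Term.ex (Term.ex t))).Holds inp 2 ρ ↔ ∃ T, Saturated n S T ∧ Q T := by
  simp only [Term.holds_ex, h.size, Nat.reduceAdd]
  constructor
  · rintro ⟨x, -, y, -, k, -, ht⟩
    exact ⟨_, (hQ _ (by simp) (by simp)).1 ht⟩
  · rintro ⟨T, hT, hQT⟩
    have h1 := hT.1.2
    refine ⟨T.x, by omega, T.y, by omega, T.size, by omega, ?_⟩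
    rw [hQ _ (by simp) (by simp)]
    simpa using ⟨hT, hQT⟩

theorem holds_forcedTerm (henc : Encodes n S inp) (h : IsArrangement n S) (hS : SpreadOut n S)
    (τ : Side) : (forcedTerm τ).Holds inp 2 ρ ↔ Forced n S ⟨ρ 0, ρ 1, τ⟩ := by
  have hint : (Term.ex ((TriTerm.hole (.var 2)).hasInner (.var 0) (.var 1) τ)).Holds inp 2 ρ ↔
      ∃ s ∈ S, (⟨ρ 0, ρ 1, τ⟩ : Segment) ∈ interiorSegments s.cells := by
    simp only [Term.holds_ex, henc.size, TriTerm.holds_hasInner, TriTerm.eval_hole,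
      Tri.mem_interiorSegments]
    rw [← henc.exists_iff (by simp [Tri.downs_zero])]
    simp [Term.eval, Segment.pos]
  rw [forced_iff h hS, forcedTerm, Term.holds_or, Term.holds_and, Term.holds_not, hint]
  refine or_congr (and_congr_left fun _ => ?_) ?_
  · refine holds_ex_tri henc fun ρ' h0 h1 => ?_
    rw [Term.holds_and, holds_saturatedTerm henc, holds_boundaryTerm, h0, h1]
  · refine holds_ex_tri henc fun ρ' h0 h1 => ?_
    rw [Term.holds_and, holds_saturatedTerm henc]
    refine and_congr_right fun hT => ?_
    rw [Term.holds_or, Term.holds_or, holds_cornerTerm henc _ _ hT.1,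
      holds_cornerTerm henc _ _ hT.1, holds_cornerTerm henc _ _ hT.1, h0, h1]
    constructor
    · rintro (h | h | h)
      exacts [⟨_, h⟩, ⟨_, h⟩, ⟨_, h⟩]
    · rintro ⟨σ, h⟩
      cases σ
      exacts [Or.inl h, Or.inr (Or.inl h), Or.inr (Or.inr h)]

/-! ### The algorithm -/

/-- The program that lists the forced segments. -/
def forcedProgram : Program :=
  forLoop 0 (forLoop 1 (.seq (emitIf (forcedTerm .bottom) Side.bottom.code)
    (.seq (emitIf (forcedTerm .left) Side.left.code)
      (emitIf (forcedTerm .right) Side.right.code))))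

/-- A bound for the running time of the program that lists the forced segments. -/
noncomputable def forcedTime : Polynomial ℕ :=
  (Polynomial.X + 1) * ((Polynomial.X + 1) * ((forcedTerm .bottom).time + 23 +
    ((forcedTerm .left).time + 23 + ((forcedTerm .right).time + 23)) + 14) + 11 + 14) + 11

theorem findsForcedSegments_forcedProgram :
    FindsForcedSegments forcedProgram fun n => forcedTime.eval n := by
  intro n S holes h hS hnodup hmem
  have henc := encodes_inputMemory h hnodup hmem
  obtain ⟨t, m, hrun, ht, -, hout⟩ := (((emits_emitIf (inputMemory n holes) (forcedTerm .bottom)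
    Side.bottom.code).seq ((emits_emitIf _ (forcedTerm .left) Side.left.code).seq
      (emits_emitIf _ (forcedTerm .right) Side.right.code))).forLoop.forLoop)
        (fun _ => 0) (inputMemory n holes) ⟨fun _ _ => rfl, fun _ hi => absurd hi (by omega)⟩
  refine ⟨t, m, hrun, ht.trans_eq (by simp [forcedTime, henc.size]), ?_⟩
  have hemit : ∀ (ρ : ℕ → ℕ) (τ : Side), {w | (forcedTerm τ).eval (inputMemory n holes) 2 ρ ≠ 0 ∧
      w = (ρ 0, ρ 1, τ.code)} = {w | Forced n S ⟨ρ 0, ρ 1, τ⟩ ∧ w = (ρ 0, ρ 1, τ.code)} :=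
    fun ρ τ => by
      ext w
      exact and_congr_left fun _ => holds_forcedTerm henc h hS τ
  have hempty : output (inputMemory n holes) = [] := rfl
  rw [hout, hempty]
  simp only [hemit, henc.size]
  ext w
  simp only [List.not_mem_nil, Set.ofPred_false, Set.empty_union, Set.mem_iUnion, Set.mem_union,
    Set.mem_ofPred_eq, Set.mem_image, exists_prop]
  constructor
  · rintro ⟨x, hx, y, hy, ⟨he, hw⟩ | ⟨he, hw⟩ | ⟨he, hw⟩⟩
    · exact ⟨_, he, hw.symm⟩
    · exact ⟨_, he, hw.symm⟩
    · exact ⟨_, he, hw.symm⟩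
  · rintro ⟨⟨x, y, τ⟩, he, rfl⟩
    have h1 := Tri.mem_ups.1 (he.pos_mem h hS)
    simp only [Segment.pos, big] at h1
    refine ⟨x, by omega, y, by omega, ?_⟩
    cases τ
    · exact Or.inl ⟨by simpa using he, by simp [Segment.code]⟩
    · exact Or.inr (Or.inl ⟨by simpa using he, by simp [Segment.code]⟩)
    · exact Or.inr (Or.inr ⟨by simpa using he, by simp [Segment.code]⟩)

end HoleyTriangle

open HoleyTriangle
theorem mainTheorem3 :
    (∀ (n : ℕ) (S : Finset Tri), IsArrangement n S → SpreadOut n S →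
      (∀ T : Tri, Saturated n S T →
        ∀ e ∈ boundary T.cells, (∀ s ∈ S, e ∉ interiorSegments s.cells) → Forced n S e) ∧
      (∀ T : Tri, Saturated n S T → ∀ (σ : Side) (r : Rhombus), CornerPlaced S T σ r →
        (∀ R : Set Rhombus, IsTiling n S R → r ∈ R) ∧ ∀ e ∈ boundary r.cells, Forced n S e) ∧
      (∀ e : Segment, Forced n S e →
        (∃ T : Tri, Saturated n S T ∧ e ∈ boundary T.cells) ∨
        ∃ T : Tri, Saturated n S T ∧ ∃ (σ : Side) (r : Rhombus),
          CornerPlaced S T σ r ∧ e ∈ boundary r.cells)) ∧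
    ∃ (p : Program) (P : Polynomial ℕ), FindsForcedSegments p fun n => P.eval n :=
  ⟨fun _ _ h hS => ⟨fun _ hT _ he heS => forced_of_mem_boundary h hT he heS,
      fun _ hT _ _ hr => ⟨fun _ hR => hr.mem_tiling h hT hR, fun _ he => hr.forced h hT he⟩,
      fun _ he => he.exists_saturated h hS⟩,
    forcedProgram, forcedTime, findsForcedSegments_forcedProgram⟩
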